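/- Let $H$ and $K$ be complex Hilbert spaces with $2\le n=\dim H\le m=\dim K<\infty$, and write $\mathcal B(L)$ for the operators on $L$. *States.* A state of $\mathcal B(L)$ is a positive linear functional with value $1$ at $\mathbf 1$. A state $\rho$ of $\mathcal B(K\otimes H)$ is separable if there are finitely many states $\sigma_k$ of $\mathcal B(K)$, states $\tau_k$ of $\mathcal B(H)$ and numbers $t_k>0$ with $\sum_k t_k=1$ such that $\rho(a\otimes b)=\sum_k t_k\,\sigma_k(a)\tau_k(b)$ for all $a\in\mathcal B(K)$, $b\in\mathcal B(H)$; otherwise it is entangled. *Entanglement preserving maps.* A unit vector $\xi\in H\otimes H$ is marginally cyclic if $(\mathcal B(H)\otimes\mathbf 1)\xi=H\otimes H$. A unital completely positive (UCP) map $\phi:\mathcal B(K)\to\mathcal B(H)$ preserves entanglement if, for every marginally cyclic unit vector $\xi\in H\otimes H$, the state $\rho_\xi$ of $\mathcal B(K\otimes H)$ determined by $\rho_\xi(a\otimes b)=\langle(\phi(a)\otimes b)\xi,\xi\rangle$ is entangled. *The probability space $(\Phi^r,P^r)$.* A UCP map $\phi:\mathcal B(K)\to\mathcal B(H)$ has rank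 $s$ if $\phi(a)=v_1^*av_1+\dots+v_s^*av_s$ for all $a$, with linearly independent operators $v_1,\dots,v_s\in\mathcal B(H,K)$. For $r\ge1$, let $\Phi^r$ be the space of all UCP maps $\mathcal B(K)\to\mathcal B(H)$ of rank at most $r$, with the topology inherited from the finite-dimensional space of linear maps $\mathcal B(K)\to\mathcal B(H)$. Let $V^r$ be the set of all $r$-tuples $v=(v_1,\dots,v_r)$ of operators $v_i\in\mathcal B(H,K)$ with $v_1^*v_1+\dots+v_r^*v_r=\mathbf 1_H$, that is, of isometries $H\to K\oplus\dots\oplus K$ ($r$ summands). Let $\mu$ be the unique Borel probability measure on $V^r$ invariant under the transitive action of the unitary group of $K\oplus\dots\oplus K$ by left multiplication. Let $P^r$ be the image of $\mu$ under $V^r\to\Phi^r$, $v\mapsto\phi_v$, where $\phi_v(a)=\sum_{i=1}^r v_i^*av_i$. Finally, let $EP(\Phi^r)$ be the set of all entanglement preserving maps in $\Phi^r$. **Theorem.** (i) For every $r=1,2,\dots,mn$, $EP(\Phi^r)$ is a relatively open subset of $\Phi^r$, and $P^r(EP(\Phi^r))>0$. (ii) For every integer $r$ with $1\le r\le n/2$,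 $P^r(EP(\Phi^r))=1$. (iii) For the maximum rank $r=mn$, $0<P^{mn}(EP(\Phi^{mn}))<1$. -/

import Mathlib

open scoped TensorProduct InnerProductSpace CStarAlgebra ComplexOrder

noncomputable section

set_option linter.unusedSectionVars false

namespace ArvesonUCP

/-! ### States of `B(L)`, separability, entanglement -/

section States

variable {L : Type*} [NormedAddCommGroup L] [InnerProductSpace ℂ L]

/-- A state of `B(L)`: a linear functional that is positive (for the Loewner order of operators)
and takes the value `1` at the identity. -/
def IsState (ρ : (L →L[ℂ] L) →ₗ[ℂ] ℂ) : Prop :=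
  (∀ x : L →L[ℂ] L, 0 ≤ x → 0 ≤ ρ x) ∧ ρ 1 = 1

variable {K H : Type*} [NormedAddCommGroup K] [InnerProductSpace ℂ K]
  [NormedAddCommGroup H] [InnerProductSpace ℂ H]

/-- A functional on `B(K ⊗ H)` is separable if it is a convex combination of product states.
`TensorProduct.mapL a b` is the operator `a ⊗ b`. -/
def IsSeparable (ρ : (K ⊗[ℂ] H →L[ℂ] K ⊗[ℂ] H) →ₗ[ℂ] ℂ) : Prop :=
  ∃ (s : ℕ) (t : Fin s → ℝ) (σ : Fin s → (K →L[ℂ] K) →ₗ[ℂ] ℂ)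
    (τ : Fin s → (H →L[ℂ] H) →ₗ[ℂ] ℂ),
    (∀ k, 0 < t k) ∧ ∑ k, t k = 1 ∧ (∀ k, IsState (σ k)) ∧ (∀ k, IsState (τ k)) ∧
      ∀ (a : K →L[ℂ] K) (b : H →L[ℂ] H),
        ρ (TensorProduct.mapL a b) = ∑ k, (t k : ℂ) * (σ k a * τ k b)

/-- An entangled state of `B(K ⊗ H)` is a state that is not separable. -/
def IsEntangled (ρ : (K ⊗[ℂ] H →L[ℂ] K ⊗[ℂ] H) →ₗ[ℂ] ℂ) : Prop :=
  IsState ρ ∧ ¬ IsSeparable ρ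

/-- `ξ ∈ H ⊗ H` is marginally cyclic if `(B(H) ⊗ 1) ξ = H ⊗ H`. -/
def MarginallyCyclic (ξ : H ⊗[ℂ] H) : Prop :=
  ∀ η : H ⊗[ℂ] H, ∃ a : H →L[ℂ] H,
    TensorProduct.mapL a (ContinuousLinearMap.id ℂ H) ξ = η

end States

variable {H K : Type*}
  [NormedAddCommGroup H] [InnerProductSpace ℂ H] [FiniteDimensional ℂ H] [CompleteSpace H]
  [NormedAddCommGroup K] [InnerProductSpace ℂ K] [FiniteDimensional ℂ K] [CompleteSpace K]

/-! ### Inflations and entanglement preserving maps -/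

/-- The inflation `φ ⊗ id : B(K ⊗ H) → B(H ⊗ H)` of `φ : B(K) → B(H)`, obtained from the
identification of `B(K ⊗ H)` with `B(K) ⊗ B(H)`. -/
def inflation (φ : (K →L[ℂ] K) →L[ℂ] (H →L[ℂ] H)) :
    (K ⊗[ℂ] H →L[ℂ] K ⊗[ℂ] H) →ₗ[ℂ] (H ⊗[ℂ] H →L[ℂ] H ⊗[ℂ] H) :=
  LinearMap.toContinuousLinearMap.toLinearMap ∘ₗ
    (homTensorHomEquiv ℂ H H H H).toLinearMap ∘ₗ
    TensorProduct.map
      (LinearMap.toContinuousLinearMap.symm.toLinearMap ∘ₗ φ.toLinearMap ∘ₗ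
        LinearMap.toContinuousLinearMap.toLinearMap) LinearMap.id ∘ₗ
    (homTensorHomEquiv ℂ K H K H).symm.toLinearMap ∘ₗ
    LinearMap.toContinuousLinearMap.symm.toLinearMap

theorem inflation_mapL (φ : (K →L[ℂ] K) →L[ℂ] (H →L[ℂ] H)) (a : K →L[ℂ] K) (b : H →L[ℂ] H) :
    inflation φ (TensorProduct.mapL a b) = TensorProduct.mapL (φ a) b := by
  have h : (homTensorHomEquiv ℂ K H K H).symm
      (LinearMap.toContinuousLinearMap.symm (TensorProduct.mapL a b)) =
      a.toLinearMap ⊗ₜ[ℂ] b.toLinearMap := by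
    rw [LinearEquiv.symm_apply_eq, homTensorHomEquiv_apply, TensorProduct.homTensorHomMap_apply]
    ext x y
    simp
  ext x
  simp only [inflation, LinearMap.comp_apply, LinearEquiv.coe_coe, h, TensorProduct.map_tmul,
    homTensorHomEquiv_apply, TensorProduct.homTensorHomMap_apply]
  simp
  rfl

/-- The functional `ρ_ξ(x) = ⟨(φ ⊗ id)(x) ξ, ξ⟩` on `B(K ⊗ H)`. -/
def pulledVectorState (φ : (K →L[ℂ] K) →L[ℂ] (H →L[ℂ] H)) (ξ : H ⊗[ℂ] H) :
    (K ⊗[ℂ] H →L[ℂ] K ⊗[ℂ] H) →ₗ[ℂ] ℂ where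
  toFun x := ⟪ξ, inflation φ x ξ⟫_ℂ
  map_add' x y := by simp [inner_add_right]
  map_smul' c x := by
    rw [map_smul]
    exact inner_smul_right ξ (inflation φ x ξ) c

/-- `φ` preserves entanglement if `ρ_ξ` is an entangled state of `B(K ⊗ H)` for every marginally
cyclic unit vector `ξ ∈ H ⊗ H`. -/
def PreservesEntanglement (φ : (K →L[ℂ] K) →L[ℂ] (H →L[ℂ] H)) : Prop :=
  ∀ ξ : H ⊗[ℂ] H, ‖ξ‖ = 1 → MarginallyCyclic ξ → IsEntangled (pulledVectorState φ ξ)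

/-! ### UCP maps and their rank -/

/-- Unital completely positive maps `B(K) → B(H)`. -/
def IsUCP (φ : (K →L[ℂ] K) →L[ℂ] (H →L[ℂ] H)) : Prop :=
  φ 1 = 1 ∧ ∃ ψ : (K →L[ℂ] K) →CP (H →L[ℂ] H), ∀ a, ψ a = φ a

/-- The map `a ↦ v₁* a v₁ + ⋯ + v_r* a v_r` from `B(K)` to `B(H)`. -/
def krausMap {r : ℕ} (v : Fin r → H →L[ℂ] K) : (K →L[ℂ] K) →L[ℂ] (H →L[ℂ] H) :=
  LinearMap.toContinuousLinearMap
    { toFun := fun a => ∑ i, (ContinuousLinearMap.adjoint (v i)) ∘L a ∘L (v i)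
      map_add' := fun a b => by
        simp [Finset.sum_add_distrib]
      map_smul' := fun c a => by
        simp [Finset.smul_sum] }

theorem krausMap_apply {r : ℕ} (v : Fin r → H →L[ℂ] K) (a : K →L[ℂ] K) :
    krausMap v a = ∑ i, (ContinuousLinearMap.adjoint (v i)) ∘L a ∘L (v i) := rfl

/-- `φ` has rank `s` if it is given by `s` linearly independent operators `v₁, …, v_s`. -/
def HasRank (φ : (K →L[ℂ] K) →L[ℂ] (H →L[ℂ] H)) (s : ℕ) : Prop :=
  ∃ v : Fin s → H →L[ℂ] K, LinearIndependent ℂ v ∧ φ = krausMap v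

variable (H K) in
/-- The space `Φ^r` of all UCP maps `B(K) → B(H)` of rank at most `r`, with the topology of the
finite-dimensional space of all linear maps `B(K) → B(H)`. -/
def UCPMaps (r : ℕ) : Set ((K →L[ℂ] K) →L[ℂ] (H →L[ℂ] H)) :=
  {φ | IsUCP φ ∧ ∃ s ≤ r, HasRank φ s}

variable (H K) in
/-- The set `EP(Φ^r)` of all entanglement preserving maps in `Φ^r`. -/
def EP (r : ℕ) : Set (UCPMaps H K r) :=
  {φ | PreservesEntanglement φ.1}

/-! ### The parameter space `V^r(H, K)` and its invariant probability measure -/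

variable (H K) in
/-- The space `V^r(H,K)` of `r`-tuples with `v₁* v₁ + ⋯ + v_r* v_r = 1`. -/
def ParamSpace (r : ℕ) : Set (Fin r → H →L[ℂ] K) :=
  {v | ∑ i, (ContinuousLinearMap.adjoint (v i)) ∘L (v i) = 1}

variable (K) in
/-- The unitary group of `M_r(B(K)) = B(K ⊕ ⋯ ⊕ K)`. -/
abbrev UnitaryGrp (r : ℕ) : Type _ :=
  unitary (CStarMatrix (Fin r) (Fin r) (K →L[ℂ] K))

/-- The action `(U v)_i = ∑ⱼ U_ij v_j` on `r`-tuples of operators. -/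
def actTuple {r : ℕ} (U : CStarMatrix (Fin r) (Fin r) (K →L[ℂ] K)) (v : Fin r → H →L[ℂ] K) :
    Fin r → H →L[ℂ] K :=
  fun i => ∑ j, U i j ∘L v j

theorem actTuple_mem {r : ℕ} (U : UnitaryGrp K r) {v : Fin r → H →L[ℂ] K}
    (hv : v ∈ ParamSpace H K r) : actTuple U.1 v ∈ ParamSpace H K r := by
  have hU : star U.1 * U.1 = 1 := Unitary.star_mul_self_of_mem U.2
  have hU' : ∀ j k, ∑ i, star (U.1 i j) * U.1 i k = if j = k then 1 else 0 := by
    intro j k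
    have := congrFun (congrFun hU j) k
    simpa [CStarMatrix.mul_apply, CStarMatrix.one_apply, CStarMatrix.star_apply] using this
  have hv' : ∑ i, (ContinuousLinearMap.adjoint (v i)) ∘L (v i) = 1 := hv
  show ∑ i, (ContinuousLinearMap.adjoint (actTuple U.1 v i)) ∘L (actTuple U.1 v i) = 1
  rw [← hv']
  have h1 : ∀ i, (ContinuousLinearMap.adjoint (actTuple U.1 v i)) ∘L (actTuple U.1 v i) =
      ∑ j, ∑ k, (ContinuousLinearMap.adjoint (v j)) ∘L (star (U.1 i j) * U.1 i k) ∘L v k := by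
    intro i
    ext x
    simp [actTuple, map_sum, ContinuousLinearMap.adjoint_comp, ContinuousLinearMap.star_eq_adjoint]
    exact Finset.sum_comm
  simp_rw [h1]
  rw [Finset.sum_comm]
  refine Finset.sum_congr rfl fun j _ => ?_
  rw [Finset.sum_comm]
  have h2 : ∀ k, ∑ i, (ContinuousLinearMap.adjoint (v j)) ∘L (star (U.1 i j) * U.1 i k) ∘L v k =
      if j = k then (ContinuousLinearMap.adjoint (v j)) ∘L v k else 0 := by
    intro k
    have : ∑ i, (ContinuousLinearMap.adjoint (v j)) ∘L (star (U.1 i j) * U.1 i k) ∘L v k =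
        (ContinuousLinearMap.adjoint (v j)) ∘L (∑ i, star (U.1 i j) * U.1 i k) ∘L v k := by
      ext x; simp
    rw [this, hU' j k]
    split_ifs <;> ext x <;> simp
  simp_rw [h2]
  simp

/-- The action of the unitary group of `B(K ⊕ ⋯ ⊕ K)` on `V^r(H,K)`. -/
def act {r : ℕ} (U : UnitaryGrp K r) (v : ParamSpace H K r) : ParamSpace H K r :=
  ⟨actTuple U.1 v.1, actTuple_mem U v.2⟩

theorem continuous_entry {r : ℕ} (i j : Fin r) :
    Continuous fun M : CStarMatrix (Fin r) (Fin r) (K →L[ℂ] K) => M i j := by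
  have h : Continuous fun M : Matrix (Fin r) (Fin r) (K →L[ℂ] K) => M i j :=
    continuous_id.matrix_elem i j
  exact h.comp (CStarMatrix.ofMatrixL (m := Fin r) (n := Fin r) (A := K →L[ℂ] K)).symm.continuous

theorem continuous_act {r : ℕ} (v : ParamSpace H K r) :
    Continuous fun U : UnitaryGrp K r => act U v := by
  refine Continuous.subtype_mk (continuous_pi fun i => ?_) _
  refine continuous_finsetSum _ fun j _ => ?_
  exact ((continuous_entry i j).comp continuous_subtype_val).clm_comp continuous_const

instance compactSpace_unitaryGrp (r : ℕ) : CompactSpace (UnitaryGrp K r) := by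
  have : FiniteDimensional ℂ (CStarMatrix (Fin r) (Fin r) (K →L[ℂ] K)) :=
    (CStarMatrix.ofMatrixL (m := Fin r) (n := Fin r)
      (A := K →L[ℂ] K)).toLinearEquiv.finiteDimensional
  have : ProperSpace (CStarMatrix (Fin r) (Fin r) (K →L[ℂ] K)) := FiniteDimensional.proper ℂ _
  refine isCompact_iff_compactSpace.mp
    (Metric.isCompact_of_isClosed_isBounded isClosed_unitary ?_)
  refine (Metric.isBounded_closedBall (x := 0) (r := 1)).subset fun U hU => ?_
  rw [mem_closedBall_zero_iff]
  rcases subsingleton_or_nontrivial (CStarMatrix (Fin r) (Fin r) (K →L[ℂ] K)) with h | h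
  · rw [Subsingleton.elim U 0]; simp
  · exact (CStarRing.norm_of_mem_unitary hU).le

instance measurableSpace_unitaryGrp (r : ℕ) : MeasurableSpace (UnitaryGrp K r) := borel _

instance borelSpace_unitaryGrp (r : ℕ) : BorelSpace (UnitaryGrp K r) := ⟨rfl⟩

variable (K) in
/-- Normalized Haar measure of the unitary group of `B(K ⊕ ⋯ ⊕ K)`. -/
def haarProb (r : ℕ) : MeasureTheory.Measure (UnitaryGrp K r) :=
  MeasureTheory.Measure.haarMeasure ⊤

open Classical in
variable (H K) in
/-- The invariant probability measure of `V^r(H,K)`: the image of normalized Haar measure under the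
orbit map `U ↦ U v₀` of a point `v₀`. The action being transitive, it does not depend on `v₀`.
(The value `0` is used only when `V^r(H,K)` is empty.) -/
def invariantMeasure (r : ℕ) : MeasureTheory.Measure (ParamSpace H K r) :=
  if h : Nonempty (ParamSpace H K r) then
    (haarProb K r).map fun U => act U h.some
  else 0

theorem isProbabilityMeasure_invariantMeasure {r : ℕ} (h : Nonempty (ParamSpace H K r)) :
    MeasureTheory.IsProbabilityMeasure (invariantMeasure H K r) := by
  have : MeasureTheory.IsProbabilityMeasure (haarProb K r) :=
    ⟨MeasureTheory.Measure.haarMeasure_self⟩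
  rw [invariantMeasure, dif_pos h]
  exact MeasureTheory.Measure.isProbabilityMeasure_map (continuous_act _).measurable.aemeasurable

theorem act_mul {r : ℕ} (U W : UnitaryGrp K r) (v : ParamSpace H K r) :
    act (U * W) v = act U (act W v) := by
  refine Subtype.ext (funext fun i => ?_)
  ext x
  simp [act, actTuple, CStarMatrix.mul_apply, map_sum]
  exact Finset.sum_comm

theorem invariantMeasure_map_act {r : ℕ} (U : UnitaryGrp K r) :
    (invariantMeasure H K r).map (act U) = invariantMeasure H K r := by
  rw [invariantMeasure]
  split_ifs with h
  · have hU : Measurable (act (H := H) U) := by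
      refine Continuous.measurable (Continuous.subtype_mk (continuous_pi fun i => ?_) _)
      refine continuous_finsetSum _ fun j _ => ?_
      exact continuous_const.clm_comp ((continuous_apply j).comp continuous_subtype_val)
    have hU' : Measurable fun W : UnitaryGrp K r => U * W :=
      (continuous_const.mul continuous_id).measurable
    have hinv : (haarProb K r).map (fun W => U * W) = haarProb K r :=
      MeasureTheory.map_mul_left_eq_self (MeasureTheory.Measure.haarMeasure ⊤) U
    rw [MeasureTheory.Measure.map_map hU (continuous_act _).measurable]
    conv_rhs => rw [← hinv, MeasureTheory.Measure.map_map (continuous_act _).measurable hU']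
    congr 1
    funext W
    exact (act_mul U W _).symm
  · simp

/-! ### The parameterization `v ↦ φ_v` and the probability measure `P^r` -/

theorem isUCP_krausMap {r : ℕ} {v : Fin r → H →L[ℂ] K} (hv : v ∈ ParamSpace H K r) :
    IsUCP (krausMap v) := by
  refine ⟨?_, ⟨(krausMap v).toLinearMap, fun k M hM => ?_⟩, fun a => rfl⟩
  · rw [krausMap_apply]
    exact hv
  rcases subsingleton_or_nontrivial H with hH | hH
  · have : M.map (krausMap v).toLinearMap = 0 := by
      ext i j x
      exact Subsingleton.elim _ _
    rw [this]
  obtain ⟨e, he⟩ := exists_norm_eq H zero_le_one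
  rcases isEmpty_or_nonempty (Fin k) with hk | ⟨⟨i₀⟩⟩
  · have : M.map (krausMap v).toLinearMap = 0 := by
      ext i
      exact hk.elim i
    rw [this]
  rw [StarOrderedRing.nonneg_iff] at hM
  induction hM using AddSubmonoid.closure_induction with
  | zero =>
    have : (0 : CStarMatrix (Fin k) (Fin k) (K →L[ℂ] K)).map (krausMap v).toLinearMap = 0 := by
      ext i j : 2
      simp
    rw [this]
  | add M N _ _ hM hN =>
    have : (M + N).map (krausMap v).toLinearMap =
        M.map (krausMap v).toLinearMap + N.map (krausMap v).toLinearMap := by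
      ext i j : 2
      simp
    rw [this]
    exact add_nonneg hM hN
  | mem M hM =>
  obtain ⟨N, rfl⟩ := hM
  let b := stdOrthonormalBasis ℂ K
  let Y : Fin k → Fin r → Fin (Module.finrank ℂ K) → CStarMatrix (Fin k) (Fin k) (H →L[ℂ] H) :=
    fun p l q => CStarMatrix.ofMatrix fun s j =>
      if s = i₀ then InnerProductSpace.rankOne ℂ e
        (ContinuousLinearMap.adjoint (N p j ∘L v l) (b q)) else 0
  have key : (star N * N).map (krausMap v).toLinearMap =
      ∑ p, ∑ l, ∑ q, star (Y p l q) * Y p l q := by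
    have hY : ∀ p l q s j, Y p l q s j = if s = i₀ then InnerProductSpace.rankOne ℂ e
        (ContinuousLinearMap.adjoint (N p j ∘L v l) (b q)) else 0 := fun _ _ _ _ _ => rfl
    have hentry : ∀ p l q i j, (star (Y p l q) * Y p l q) i j =
        InnerProductSpace.rankOne ℂ (ContinuousLinearMap.adjoint (N p i ∘L v l) (b q))
          (ContinuousLinearMap.adjoint (N p j ∘L v l) (b q)) := by
      intro p l q i j
      rw [CStarMatrix.mul_apply, Finset.sum_eq_single i₀]
      · simp only [CStarMatrix.star_apply, hY, if_true,
          ContinuousLinearMap.star_eq_adjoint, InnerProductSpace.adjoint_rankOne]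
        ext x
        simp [inner_self_eq_norm_sq_to_K, he]
      · intro s _ hs
        simp [hY, hs]
      · simp
    have hsum : ∀ {ι : Type} (S : Finset ι)
        (f : ι → CStarMatrix (Fin k) (Fin k) (H →L[ℂ] H)) i j,
        (∑ p ∈ S, f p) i j = ∑ p ∈ S, f p i j := by
      intro ι S f i j
      exact map_sum (AddMonoidHom.mk' (fun M : CStarMatrix (Fin k) (Fin k) (H →L[ℂ] H) => M i j)
        fun _ _ => rfl) f S
    ext i j x
    simp only [hsum, hentry, CStarMatrix.map_apply, CStarMatrix.mul_apply]
    simp only [ContinuousLinearMap.coe_coe, map_sum, sum_apply]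
    refine Finset.sum_congr rfl fun p _ => ?_
    rw [krausMap_apply, sum_apply]
    refine Finset.sum_congr rfl fun l _ => ?_
    have hb : ∑ q, ⟪b q, N p j (v l x)⟫_ℂ • b q = N p j (v l x) := b.sum_repr' _
    simp only [InnerProductSpace.rankOne_apply, ContinuousLinearMap.adjoint_inner_left,
      ContinuousLinearMap.comp_apply, mul_apply_eq_comp]
    simp only [ContinuousLinearMap.adjoint_comp, ContinuousLinearMap.comp_apply,
      CStarMatrix.star_apply, ContinuousLinearMap.star_eq_adjoint]
    conv_lhs => rw [← hb]
    simp only [map_sum, map_smul]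
  rw [key]
  exact Finset.sum_nonneg fun p _ => Finset.sum_nonneg fun l _ => Finset.sum_nonneg fun q _ =>
    star_mul_self_nonneg _

theorem exists_hasRank_krausMap {r : ℕ} (v : Fin r → H →L[ℂ] K) :
    ∃ s ≤ r, HasRank (krausMap v) s := by
  induction r with
  | zero => exact ⟨0, le_rfl, v, linearIndependent_empty_type, rfl⟩
  | succ r ih =>
    by_cases hli : LinearIndependent ℂ v
    · exact ⟨r + 1, le_rfl, v, hli, rfl⟩
    rw [Fintype.not_linearIndependent_iff] at hli
    obtain ⟨c, hc, i, hi⟩ := hli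
    let c' : EuclideanSpace ℂ (Fin (r + 1)) := WithLp.toLp 2 c
    have hc' : c' ≠ 0 := fun h => hi (by simpa [c'] using congrArg (fun z => z i) h)
    let u : EuclideanSpace ℂ (Fin (r + 1)) := ((‖c'‖⁻¹ : ℝ) : ℂ) • c'
    have hu : ‖u‖ = 1 := by
      simp only [u, norm_smul, Complex.norm_real, norm_inv, norm_norm]
      exact inv_mul_cancel₀ (norm_ne_zero_iff.mpr hc')
    have hu0 : ∑ j, u j • v j = 0 := by
      have : ∀ j, u j • v j = ((‖c'‖⁻¹ : ℝ) : ℂ) • (c j • v j) := fun j => by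
        simp only [u, c', PiLp.smul_apply, smul_eq_mul, mul_smul]
      simp_rw [this, ← Finset.smul_sum, hc, smul_zero]
    obtain ⟨b, hb⟩ := Orthonormal.exists_orthonormalBasis_extension_of_card_eq (𝕜 := ℂ)
      (E := EuclideanSpace ℂ (Fin (r + 1))) (ι := Fin (r + 1)) (by simp) (v := fun _ => u)
      (s := {0}) (by
        constructor
        · intro i; simpa using hu
        · intro i j hij; exact absurd (Subsingleton.elim i j) hij)
    have hb0 : b 0 = u := hb 0 rfl
    let w : Fin (r + 1) → H →L[ℂ] K := fun i => ∑ j, b i j • v j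
    have hw0 : w 0 = 0 := by simp only [w, hb0, hu0]
    have horth : ∀ j k, ∑ i, star (b i j) * b i k = if j = k then 1 else 0 := by
      intro j k
      have := b.sum_inner_mul_inner (EuclideanSpace.single k 1) (EuclideanSpace.single j 1)
      simp only [EuclideanSpace.inner_single_left, EuclideanSpace.inner_single_right, map_one,
        one_mul, PiLp.single_apply] at this
      simpa [mul_comm, eq_comm] using this
    have hkraus : krausMap v = krausMap w := by
      ext a x
      have hadj : ∀ i j (z : K), ContinuousLinearMap.adjoint (b i j • v j) z =
          star (b i j) • ContinuousLinearMap.adjoint (v j) z := by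
        intro i j z
        rw [map_smulₛₗ]
        rfl
      have hterm : ∀ i, ContinuousLinearMap.adjoint (w i) (a (w i x)) =
          ∑ j, ∑ k, (star (b i j) * b i k) • ContinuousLinearMap.adjoint (v j) (a (v k x)) := by
        intro i
        simp only [w, map_sum, sum_apply, hadj,
          smul_apply, map_smul, mul_smul]
        rw [Finset.sum_comm]
        simp only [Finset.smul_sum, smul_comm (star _)]
      simp only [krausMap_apply, sum_apply, ContinuousLinearMap.comp_apply,
        hterm]
      rw [Finset.sum_comm]
      refine Finset.sum_congr rfl fun j _ => ?_
      rw [Finset.sum_comm]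
      simp only [← Finset.sum_smul, horth, ite_smul, one_smul, zero_smul]
      simp
    obtain ⟨s, hs, hrank⟩ := ih fun i => w i.succ
    refine ⟨s, hs.trans (Nat.le_succ r), ?_⟩
    have : krausMap w = krausMap fun i => w i.succ := by
      ext1 a
      rw [krausMap_apply, krausMap_apply, Fin.sum_univ_succ, hw0]
      simp
    rw [hkraus, this]
    exact hrank

/-- The parameterization `V^r(H,K) → Φ^r`, `v ↦ φ_v`, with `φ_v(a) = v₁* a v₁ + ⋯ + v_r* a v_r`. -/
def toUCP {r : ℕ} (v : ParamSpace H K r) : UCPMaps H K r :=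
  ⟨krausMap v.1, isUCP_krausMap v.2, exists_hasRank_krausMap v.1⟩

variable (H K) in
/-- The probability measure `P^r` on the Borel sets of `Φ^r`: the image of the invariant probability
measure of `V^r(H,K)` under `v ↦ φ_v`. -/
def ucpMeasure (r : ℕ) : MeasureTheory.Measure (UCPMaps H K r) :=
  (invariantMeasure H K r).map toUCP

theorem continuous_toUCP {r : ℕ} :
    Continuous (toUCP : ParamSpace H K r → UCPMaps H K r) := by
  refine Continuous.subtype_mk (continuous_clm_apply.mpr fun a => ?_) _
  simp_rw [krausMap_apply]
  refine continuous_finsetSum _ fun i _ => ?_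
  have hi : Continuous fun v : ParamSpace H K r => v.1 i :=
    (continuous_apply i).comp continuous_subtype_val
  exact (ContinuousLinearMap.adjoint.continuous.comp hi).clm_comp (continuous_const.clm_comp hi)

theorem ucpMeasure_apply {r : ℕ} {E : Set (UCPMaps H K r)} (hE : MeasurableSet E) :
    ucpMeasure H K r E = invariantMeasure H K r {v | toUCP v ∈ E} :=
  MeasureTheory.Measure.map_apply continuous_toUCP.measurable hE

end ArvesonUCP
end

/-!
Write `φ(a) = ∑ vᵢ* a vᵢ`. The state `ρ_ξ` is then the sum of the vector functionals of the vectors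
`(vᵢ ⊗ 1) ξ`, so its density operator has the span of these vectors as its range.

A marginally cyclic `ξ` is also cyclic for the second leg, so any two marginally cyclic vectors
differ by an operator `1 ⊗ c`. This operator turns a decomposition of `ρ_ξ` into product vectors
`x ⊗ y` into one with product vectors `x ⊗ c y`. Hence `φ` preserves entanglement as soon as `ρ_ξ`
is entangled for one fixed marginally cyclic unit vector `ξ`
(`preservesEntanglement_krausMap_iff`). The separable states are the convex hull of the
compact set of product vector states, by Carathéodory's theorem a compact set
(`isCompact_sepStates`), and `φ ↦ ρ_ξ` is continuous; this gives openness (`isOpen_EP`).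

If `ρ_ξ` is separable, then the product vectors `xⱼ ⊗ yⱼ` of a decomposition lie in the span of the
`r` vectors `(vᵢ ⊗ 1) ξ`, while the `yⱼ` with `xⱼ ≠ 0` span `H` because `ξ` is separating for the
second leg. Slicing with a functional that is nonzero at every nonzero `xⱼ` gives `dim H ≤ r`. So
every UCP map of rank less than `dim H` preserves entanglement
(`preservesEntanglement_krausMap_of_lt`), which is stronger than what part (ii) needs. Applied to
rank one maps, it shows that `EP(Φ^r)` contains `a ↦ v* a v` for an isometry `v`. Nonempty open sets
have positive measure because the unitary group acts transitively on `V^r` (`exists_act_eq`), and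
positivity of `P^r(EP(Φ^r))` follows for all `r`.

At maximal rank, the completely depolarizing map `φ₀(a) = m⁻¹ tr(a) 1` is available. By polarization
`a = ∑ ⟨x_α, a x_α⟩ b_α`, while `φ₀(a) = c ∑ ⟨x_α, a x_α⟩ 1` for a constant `c > 0`. A UCP map `φ`
close to `φ₀` is therefore `φ(a) = ∑ ⟨x_α, a x_α⟩ T_α` with `T_α = c + (φ - φ₀)(b_α)`. As `φ`
preserves adjoints, `T_α` may be replaced by its self-adjoint part, which is positive, and then
all the states `ρ_ξ` are visibly separable (`pulledForm_mem_sepStates_of_near`). So the complement of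
`EP(Φ^{mn})` contains a nonempty open set, and has positive measure.
-/

noncomputable section

set_option linter.unusedSectionVars false

namespace ArvesonUCP

/-! ### Convex hulls of compact sets -/

section ConvexHull

/-- The convex hull of a compact set in a finite-dimensional space is compact: by Carathéodory's
theorem it is the image of a compact set of weights and points. -/
theorem isCompact_convexHull_of_isCompact {E : Type*} [NormedAddCommGroup E] [NormedSpace ℝ E]
    [FiniteDimensional ℝ E] {s : Set E} (hs : IsCompact s) : IsCompact (convexHull ℝ s) := by
  rcases s.eq_empty_or_nonempty with rfl | ⟨p, hp⟩
  · simp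
  let d := Module.finrank ℝ E + 1
  let f : (Fin d → ℝ) × (Fin d → E) → E := fun q => ∑ i, q.1 i • q.2 i
  have hf : Continuous f := by fun_prop
  have hcomp := ((isCompact_stdSimplex ℝ (Fin d)).prod
    (isCompact_univ_pi fun _ : Fin d => hs)).image hf
  convert hcomp using 1
  refine Set.Subset.antisymm (fun x hx => ?_) ?_
  · obtain ⟨ι, _, z, w, hz, hind, hw, hw1, rfl⟩ := eq_pos_convex_span_of_mem_convexHull hx
    have hcard : Fintype.card ι ≤ Fintype.card (Fin d) := by
      rw [Fintype.card_fin]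
      exact hind.card_le_finrank_succ.trans (Nat.succ_le_succ (Submodule.finrank_le _))
    obtain ⟨e⟩ := Function.Embedding.nonempty_of_card_le hcard
    have hw' : ∀ i, Function.extend e w 0 (e i) = w i := e.injective.extend_apply _ _
    have hz' : ∀ i, Function.extend e z (fun _ => p) (e i) = z i := e.injective.extend_apply _ _
    have hw0 : ∀ j, j ∉ Set.range e → Function.extend e w 0 j = 0 := fun j hj =>
      Function.extend_apply' _ _ _ hj
    refine ⟨(Function.extend e w 0, Function.extend e z fun _ => p), ⟨⟨fun j => ?_, ?_⟩,
      fun j _ => ?_⟩, ?_⟩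
    · by_cases hj : j ∈ Set.range e
      · obtain ⟨i, rfl⟩ := hj
        exact (hw i).le.trans_eq (hw' i).symm
      · exact (hw0 j hj).ge
    · rw [← hw1]
      exact (Fintype.sum_of_injective e e.injective _ _ hw0 fun i => (hw' i).symm).symm
    · change Function.extend e z (fun _ => p) j ∈ s
      by_cases hj : j ∈ Set.range e
      · obtain ⟨i, rfl⟩ := hj
        rw [hz']
        exact hz ⟨i, rfl⟩
      · rw [Function.extend_apply' z (fun _ => p) j hj]
        exact hp
    · refine (Fintype.sum_of_injective e e.injective _ _ (fun j hj => ?_) fun i => ?_).symm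
      · simp only [hw0 j hj, zero_smul]
      · simp only [hw', hz']
  · rintro _ ⟨⟨w, z⟩, ⟨hw, hz⟩, rfl⟩
    exact (convex_convexHull ℝ s).sum_mem (fun i _ => hw.1 i) hw.2 fun i _ =>
      subset_convexHull ℝ s (hz i trivial)

variable {E : Type*} [NormedAddCommGroup E] [NormedSpace ℂ E]

/-- The convex hull of a subset of a complex normed space, for the underlying real structure. -/
def realHull (s : Set E) : Set E := convexHull ℝ s

theorem isCompact_realHull [FiniteDimensional ℂ E] {s : Set E} (hs : IsCompact s) :
    IsCompact (realHull s) := by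
  have : FiniteDimensional ℝ E := FiniteDimensional.complexToReal E
  exact isCompact_convexHull_of_isCompact hs

theorem sum_mem_realHull {s : Set E} {ι : Type*} [Fintype ι] {w : ι → ℝ} {z : ι → E}
    (hw : ∀ i, 0 ≤ w i) (hw1 : ∑ i, w i = 1) (hz : ∀ i, z i ∈ s) :
    ∑ i, (w i : ℂ) • z i ∈ realHull s :=
  (convex_convexHull ℝ s).sum_mem (fun i _ => hw i) hw1 fun i _ => subset_convexHull ℝ s (hz i)

theorem exists_sum_of_mem_realHull {s : Set E} {x : E} (hx : x ∈ realHull s) :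
    ∃ (N : ℕ) (w : Fin N → ℝ) (z : Fin N → E), (∀ i, 0 < w i) ∧ ∑ i, w i = 1 ∧ (∀ i, z i ∈ s) ∧
      x = ∑ i, (w i : ℂ) • z i := by
  obtain ⟨ι, _, z, w, hz, -, hw, hw1, rfl⟩ := eq_pos_convex_span_of_mem_convexHull hx
  let e := Fintype.equivFin ι
  refine ⟨_, w ∘ e.symm, z ∘ e.symm, fun i => hw _, ?_, fun i => hz ⟨_, rfl⟩, ?_⟩
  · exact (e.symm.sum_comp w).trans hw1
  · exact (e.symm.sum_comp fun i => w i • z i).symm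

end ConvexHull

/-! ### Vector functionals and positive functionals on `B(L)` -/

section VectorFunctionals

variable {L : Type*} [NormedAddCommGroup L] [InnerProductSpace ℂ L]

/-- The continuous functionals on `B(L)`. -/
abbrev Functional (L : Type*) [NormedAddCommGroup L] [InnerProductSpace ℂ L] : Type _ :=
  (L →L[ℂ] L) →L[ℂ] ℂ

/-- The vector functional `a ↦ ⟨x, a x⟩` on `B(L)`. -/
def vecForm (x : L) : Functional L :=
  (innerSL ℂ x) ∘L (ContinuousLinearMap.apply ℂ L x)

@[simp]
theorem vecForm_apply (x : L) (a : L →L[ℂ] L) : vecForm x a = ⟪x, a x⟫_ℂ := rfl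

theorem vecForm_one (x : L) : vecForm x 1 = ((‖x‖ ^ 2 : ℝ) : ℂ) := by
  simp [inner_self_eq_norm_sq_to_K]

theorem vecForm_smul_of_real (t : ℝ) (x : L) :
    vecForm ((t : ℂ) • x) = ((t ^ 2 : ℝ) : ℂ) • vecForm x := by
  ext a
  simp [pow_two, mul_assoc]

theorem vecForm_nonneg (x : L) {a : L →L[ℂ] L} (ha : 0 ≤ a) : 0 ≤ vecForm x a :=
  ((ContinuousLinearMap.nonneg_iff_isPositive a).mp ha).inner_nonneg_right x

theorem vecForm_rankOne (x z : L) :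
    vecForm x (InnerProductSpace.rankOne ℂ z z) = ((‖⟪z, x⟫_ℂ‖ ^ 2 : ℝ) : ℂ) := by
  simp only [vecForm_apply, InnerProductSpace.rankOne_apply, inner_smul_right]
  rw [← inner_conj_symm x z, Complex.mul_conj, Complex.normSq_eq_norm_sq]

theorem isState_vecForm {x : L} (hx : ‖x‖ = 1) : IsState (vecForm x).toLinearMap :=
  ⟨fun _ ha => vecForm_nonneg x ha, by
    simp [hx]⟩

variable [FiniteDimensional ℂ L] [CompleteSpace L]

theorem continuous_vecForm : Continuous (vecForm : L → Functional L) := by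
  refine continuous_clm_apply.mpr fun a => ?_
  simp only [vecForm_apply]
  fun_prop

/-- Two functionals on `B(L)` agreeing on the operators `|y⟩⟨x|` are equal. -/
theorem functional_ext_rankOne {σ τ : (L →L[ℂ] L) →ₗ[ℂ] ℂ}
    (h : ∀ x y : L, σ (InnerProductSpace.rankOne ℂ y x) = τ (InnerProductSpace.rankOne ℂ y x)) :
    σ = τ := by
  ext a
  let b := stdOrthonormalBasis ℂ L
  have ha : a = ∑ i, InnerProductSpace.rankOne ℂ (a (b i)) (b i) := by
    ext x
    conv_lhs => rw [← b.sum_repr' x]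
    simp
  rw [ha, map_sum, map_sum]
  exact Finset.sum_congr rfl fun i _ => h _ _

/-- A positive functional on `B(L)` is a finite sum of vector functionals: the vectors come from
a decomposition of its density operator `D`, given by `⟨x, D y⟩ = σ(|y⟩⟨x|)`, into positive
operators of rank one. -/
theorem exists_eq_sum_vecForm {σ : (L →L[ℂ] L) →ₗ[ℂ] ℂ} (hσ : ∀ x, 0 ≤ x → 0 ≤ σ x) :
    ∃ (N : ℕ) (u : Fin N → L), ∀ a, σ a = ∑ i, vecForm (u i) a := by
  let b := stdOrthonormalBasis ℂ L
  let D : L →L[ℂ] L := LinearMap.toContinuousLinearMap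
    { toFun := fun y => ∑ i, σ (InnerProductSpace.rankOne ℂ y (b i)) • b i
      map_add' := fun y z => by simp [add_smul, Finset.sum_add_distrib]
      map_smul' := fun c y => by simp [Finset.smul_sum, mul_smul] }
  have hDapp : ∀ y, D y = ∑ i, σ (InnerProductSpace.rankOne ℂ y (b i)) • b i := fun y => rfl
  have hD : ∀ x y, ⟪x, D y⟫_ℂ = σ (InnerProductSpace.rankOne ℂ y x) := by
    intro x y
    have hx : InnerProductSpace.rankOne ℂ y x =
        ∑ i, ⟪x, b i⟫_ℂ • InnerProductSpace.rankOne ℂ y (b i) := by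
      ext z
      simp only [InnerProductSpace.rankOne_apply, sum_apply, smul_apply, smul_smul,
        ← Finset.sum_smul, b.sum_inner_mul_inner]
    rw [hDapp, hx, map_sum, inner_sum]
    refine Finset.sum_congr rfl fun i _ => ?_
    rw [inner_smul_right, map_smul, smul_eq_mul, mul_comm]
  have hpos : D.IsPositive := by
    rw [ContinuousLinearMap.isPositive_iff_complex]
    intro x
    have h0 : 0 ≤ ⟪x, D x⟫_ℂ := by
      rw [hD]
      exact hσ _ ((ContinuousLinearMap.nonneg_iff_isPositive _).mpr
        (InnerProductSpace.isPositive_rankOne_self x))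
    have h1 : 0 ≤ ⟪D x, x⟫_ℂ := by
      rw [← inner_conj_symm]
      simpa using (star_nonneg_iff (x := ⟪x, D x⟫_ℂ)).mpr h0
    rw [Complex.nonneg_iff] at h1
    exact ⟨Complex.ext (by simp) (by simpa using h1.2), h1.1⟩
  obtain ⟨N, u, hu⟩ := ContinuousLinearMap.isPositive_iff_eq_sum_rankOne.mp hpos
  refine ⟨N, u, fun a => ?_⟩
  have : σ = ∑ i, (vecForm (u i)).toLinearMap := by
    refine functional_ext_rankOne fun x y => ?_
    rw [← hD, hu]
    simp [mul_comm]
  rw [this]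
  simp

end VectorFunctionals

/-! ### Operators on tensor products -/

section Tensor

variable {E F G M : Type*} [NormedAddCommGroup E] [InnerProductSpace ℂ E]
  [NormedAddCommGroup F] [InnerProductSpace ℂ F]
  [NormedAddCommGroup G] [InnerProductSpace ℂ G]
  [NormedAddCommGroup M] [InnerProductSpace ℂ M]

theorem vecForm_tmul (x : E) (y : F) (a : E →L[ℂ] E) (b : F →L[ℂ] F) :
    vecForm (x ⊗ₜ[ℂ] y) (TensorProduct.mapL a b) = vecForm x a * vecForm y b := by
  simp

theorem mapL_one_one : TensorProduct.mapL (1 : E →L[ℂ] E) (1 : F →L[ℂ] F) = 1 :=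
  TensorProduct.mapL_id_id

theorem vecForm_smul_tmul (t : ℝ) (x : E) (y : F) :
    vecForm (((t : ℂ) • x) ⊗ₜ[ℂ] y) = ((t ^ 2 : ℝ) : ℂ) • vecForm (x ⊗ₜ[ℂ] y) := by
  rw [← vecForm_smul_of_real]
  congr 1

theorem vecForm_smul_tmul_smul (s t : ℝ) (x : E) (y : F) :
    vecForm (((s : ℂ) • x) ⊗ₜ[ℂ] ((t : ℂ) • y)) =
      (((s * t) ^ 2 : ℝ) : ℂ) • vecForm (x ⊗ₜ[ℂ] y) := by
  rw [← vecForm_smul_of_real]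
  congr 1
  push_cast
  exact TensorProduct.smul_tmul_smul _ _ _ _

theorem mapL_sum_left {κ : Type*} (s : Finset κ) (f : κ → E →L[ℂ] G) (b : F →L[ℂ] M) :
    TensorProduct.mapL (∑ i ∈ s, f i) b = ∑ i ∈ s, TensorProduct.mapL (f i) b :=
  map_sum (AddMonoidHom.mk' (fun a : E →L[ℂ] G => TensorProduct.mapL a b)
    fun a a' => TensorProduct.mapL_add_left a a' b) f s

variable [FiniteDimensional ℂ E] [FiniteDimensional ℂ F] [CompleteSpace E] [CompleteSpace F]
  [FiniteDimensional ℂ G] [FiniteDimensional ℂ M] [CompleteSpace G] [CompleteSpace M]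

/-- The operators `a ⊗ b` span `B(E ⊗ F)`. -/
theorem mapL_induction {p : (E ⊗[ℂ] F →L[ℂ] E ⊗[ℂ] F) → Prop}
    (h : ∀ a b, p (TensorProduct.mapL a b)) (hadd : ∀ x y, p x → p y → p (x + y))
    (x : E ⊗[ℂ] F →L[ℂ] E ⊗[ℂ] F) : p x := by
  obtain ⟨z, hz⟩ : ∃ z, LinearMap.toContinuousLinearMap (homTensorHomEquiv ℂ E F E F z) = x :=
    ⟨(homTensorHomEquiv ℂ E F E F).symm (LinearMap.toContinuousLinearMap.symm x), by
      rw [LinearEquiv.apply_symm_apply, LinearEquiv.apply_symm_apply]⟩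
  rw [← hz]
  clear hz
  induction z with
  | zero => simpa using h 0 0
  | add z w hz hw => simpa using hadd _ _ hz hw
  | tmul a b =>
    convert h (LinearMap.toContinuousLinearMap a) (LinearMap.toContinuousLinearMap b) using 1
    ext z
    simp [homTensorHomEquiv_apply]

theorem functional_ext_mapL {ρ ρ' : (E ⊗[ℂ] F →L[ℂ] E ⊗[ℂ] F) →ₗ[ℂ] ℂ}
    (h : ∀ a b, ρ (TensorProduct.mapL a b) = ρ' (TensorProduct.mapL a b)) : ρ = ρ' := by
  ext x
  induction x using mapL_induction with
  | h a b => exact h a b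
  | hadd x y hx hy => rw [map_add, map_add, hx, hy]

theorem inner_mapL_adjoint (a : G →L[ℂ] E) (b : M →L[ℂ] F) (ξ : E ⊗[ℂ] F) (η : G ⊗[ℂ] M) :
    ⟪ξ, TensorProduct.mapL a b η⟫_ℂ =
      ⟪TensorProduct.mapL (ContinuousLinearMap.adjoint a) (ContinuousLinearMap.adjoint b) ξ,
        η⟫_ℂ := by
  have : CompleteSpace (E ⊗[ℂ] F) := FiniteDimensional.complete ℂ _
  have : CompleteSpace (G ⊗[ℂ] M) := FiniteDimensional.complete ℂ _
  rw [← TensorProduct.adjoint_mapL, ContinuousLinearMap.adjoint_inner_left]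

end Tensor

variable {H K : Type*}
  [NormedAddCommGroup H] [InnerProductSpace ℂ H] [FiniteDimensional ℂ H] [CompleteSpace H]
  [NormedAddCommGroup K] [InnerProductSpace ℂ K] [FiniteDimensional ℂ K] [CompleteSpace K]

/-! ### The compact convex set of separable states -/

section Separable

variable (H K) in
/-- The convex hull of the product vector states of `B(K ⊗ H)`. -/
def sepStates : Set (Functional (K ⊗[ℂ] H)) :=
  realHull {ω | ∃ x : K, ∃ y : H, ‖x‖ = 1 ∧ ‖y‖ = 1 ∧ vecForm (x ⊗ₜ[ℂ] y) = ω}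

theorem isCompact_sepStates : IsCompact (sepStates H K) := by
  have : CompleteSpace (K ⊗[ℂ] H) := FiniteDimensional.complete ℂ _
  have : ProperSpace K := FiniteDimensional.proper ℂ K
  have : ProperSpace H := FiniteDimensional.proper ℂ H
  refine isCompact_realHull ?_
  have hc : Continuous fun p : K × H => vecForm (p.1 ⊗ₜ[ℂ] p.2) :=
    continuous_vecForm.comp (by fun_prop)
  have himg := ((isCompact_sphere (0 : K) 1).prod (isCompact_sphere (0 : H) 1)).image hc
  have hset : {ω : Functional (K ⊗[ℂ] H) | ∃ x : K, ∃ y : H, ‖x‖ = 1 ∧ ‖y‖ = 1 ∧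
      vecForm (x ⊗ₜ[ℂ] y) = ω} = (fun p : K × H => vecForm (p.1 ⊗ₜ[ℂ] p.2)) ''
        (Metric.sphere (0 : K) 1 ×ˢ Metric.sphere (0 : H) 1) := by
    ext ω
    constructor
    · rintro ⟨x, y, hx, hy, h⟩
      exact ⟨(x, y), ⟨by simpa using hx, by simpa using hy⟩, h⟩
    · rintro ⟨⟨x, y⟩, ⟨hx, hy⟩, h⟩
      exact ⟨x, y, by simpa using hx, by simpa using hy, h⟩
  rw [hset]
  exact himg

theorem exists_unit_smul {L : Type*} [NormedAddCommGroup L] [InnerProductSpace ℂ L] [Nontrivial L]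
    (x : L) : ∃ u : L, ‖u‖ = 1 ∧ x = (‖x‖ : ℂ) • u := by
  rcases eq_or_ne x 0 with rfl | hx
  · obtain ⟨u, hu⟩ := exists_norm_eq L zero_le_one
    exact ⟨u, hu, by simp⟩
  · refine ⟨(‖x‖⁻¹ : ℂ) • x, ?_, ?_⟩
    · rw [norm_smul]
      simp [hx]
    · rw [smul_smul, mul_inv_cancel₀ (by simpa using hx), one_smul]

/-- The product functionals `⟨x, · x⟩ ⊗ ⟨y, · y⟩` need not be normalized individually. -/
theorem mem_sepStates_of_sum [Nontrivial H] [Nontrivial K] {ι : Type*} [Fintype ι]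
    {ω : Functional (K ⊗[ℂ] H)} (x : ι → K) (y : ι → H)
    (h : ω = ∑ i, vecForm (x i ⊗ₜ[ℂ] y i)) (h1 : ω 1 = 1) : ω ∈ sepStates H K := by
  choose x' hx' hxx using fun i => exists_unit_smul (x i)
  choose y' hy' hyy using fun i => exists_unit_smul (y i)
  have hterm : ∀ i, vecForm (x i ⊗ₜ[ℂ] y i) =
      (((‖x i‖ * ‖y i‖) ^ 2 : ℝ) : ℂ) • vecForm (x' i ⊗ₜ[ℂ] y' i) := by
    intro i
    rw [← vecForm_smul_tmul_smul, ← hxx i, ← hyy i]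
  have hsum : ∑ i, (‖x i‖ * ‖y i‖) ^ 2 = 1 := by
    rw [h, sum_apply] at h1
    simp only [vecForm_one, TensorProduct.norm_tmul] at h1
    exact_mod_cast h1
  rw [h, Finset.sum_congr rfl fun i _ => hterm i]
  exact sum_mem_realHull (fun i => sq_nonneg _) hsum fun i =>
    ⟨x' i, y' i, hx' i, hy' i, rfl⟩

theorem exists_sum_of_mem_sepStates {ω : Functional (K ⊗[ℂ] H)}
    (h : ω ∈ sepStates H K) : ∃ (N : ℕ) (x : Fin N → K) (y : Fin N → H),
      ω = ∑ i, vecForm (x i ⊗ₜ[ℂ] y i) := by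
  obtain ⟨N, w, z, hw, -, hz, rfl⟩ := exists_sum_of_mem_realHull h
  choose x y _ _ hxy using hz
  refine ⟨N, fun i => ((√(w i) : ℝ) : ℂ) • x i, y, Finset.sum_congr rfl fun i _ => ?_⟩
  rw [vecForm_smul_tmul, Real.sq_sqrt (hw i).le, hxy]

/-- Every state is a sum of vector functionals, so a convex combination of product states is one of
product vector states; conversely, Carathéodory's theorem provides positive weights. -/
theorem isSeparable_iff [Nontrivial H] [Nontrivial K]
    {ω : Functional (K ⊗[ℂ] H)} :
    IsSeparable ω.toLinearMap ↔ ω ∈ sepStates H K := by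
  constructor
  · rintro ⟨s, t, σ, τ, ht, ht1, hσ, hτ, h⟩
    have h1 : ω 1 = 1 := by
      have := h 1 1
      simp only [(hσ _).2, (hτ _).2, mapL_one_one, mul_one] at this
      rw [ContinuousLinearMap.coe_coe] at this
      rw [this]
      exact_mod_cast ht1
    choose N u hu using fun k => exists_eq_sum_vecForm (hσ k).1
    choose M w hw using fun k => exists_eq_sum_vecForm (hτ k).1
    refine mem_sepStates_of_sum (ι := Σ k, Fin (N k) × Fin (M k))
      (fun p => ((√(t p.1) : ℝ) : ℂ) • u p.1 p.2.1) (fun p => w p.1 p.2.2) ?_ h1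
    refine ContinuousLinearMap.coe_injective (functional_ext_mapL fun a b => ?_)
    rw [h a b, ContinuousLinearMap.coe_coe, sum_apply, Fintype.sum_sigma]
    refine Finset.sum_congr rfl fun k _ => ?_
    rw [hu, hw, Fintype.sum_prod_type, Finset.sum_mul_sum, Finset.mul_sum]
    refine Finset.sum_congr rfl fun i _ => ?_
    rw [Finset.mul_sum]
    refine Finset.sum_congr rfl fun j _ => ?_
    dsimp only
    rw [vecForm_smul_tmul, Real.sq_sqrt (ht _).le, smul_apply, vecForm_tmul,
      smul_eq_mul]
  · intro h
    obtain ⟨N, w, z, hw, hw1, hz, rfl⟩ := exists_sum_of_mem_realHull h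
    choose x y hx hy hxy using hz
    refine ⟨N, w, fun k => (vecForm (x k)).toLinearMap, fun k => (vecForm (y k)).toLinearMap, hw,
      hw1, fun k => isState_vecForm (hx _), fun k => isState_vecForm (hy _), fun a b => ?_⟩
    rw [ContinuousLinearMap.coe_coe, sum_apply]
    refine Finset.sum_congr rfl fun k _ => ?_
    rw [← hxy, smul_apply, vecForm_tmul, smul_eq_mul]
    rfl

end Separable

/-! ### Kraus form of the states `ρ_ξ`, and marginally cyclic vectors -/

section PulledState

/-- The pulled back state of a map in Kraus form is the sum of the vector functionals given by
`(vᵢ ⊗ 1) ξ`. -/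
theorem pulledVectorState_krausMap {r : ℕ} (v : Fin r → H →L[ℂ] K) (ξ : H ⊗[ℂ] H) :
    pulledVectorState (krausMap v) ξ =
      (∑ i, vecForm (TensorProduct.mapL (v i) (1 : H →L[ℂ] H) ξ)).toLinearMap := by
  refine functional_ext_mapL fun a b => ?_
  rw [ContinuousLinearMap.coe_coe, sum_apply]
  change ⟪ξ, inflation _ _ ξ⟫_ℂ = _
  rw [inflation_mapL, krausMap_apply, mapL_sum_left, sum_apply, inner_sum]
  refine Finset.sum_congr rfl fun i _ => ?_
  have : TensorProduct.mapL (ContinuousLinearMap.adjoint (v i) ∘L a ∘L v i) b =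
      TensorProduct.mapL (ContinuousLinearMap.adjoint (v i)) (1 : H →L[ℂ] H) ∘L
        TensorProduct.mapL a b ∘L TensorProduct.mapL (v i) (1 : H →L[ℂ] H) := by
    rw [← TensorProduct.mapL_comp, ← TensorProduct.mapL_comp]
    rfl
  rw [this, ContinuousLinearMap.comp_apply, inner_mapL_adjoint,
    ContinuousLinearMap.adjoint_adjoint, ContinuousLinearMap.comp_apply, vecForm_apply,
    ← ContinuousLinearMap.star_eq_adjoint, star_one]

/-- The unnormalized maximally entangled vector `∑ᵢ eᵢ ⊗ eᵢ`. -/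
def maxEntangled (H : Type*) [NormedAddCommGroup H] [InnerProductSpace ℂ H]
    [FiniteDimensional ℂ H] : H ⊗[ℂ] H :=
  ∑ i, stdOrthonormalBasis ℂ H i ⊗ₜ[ℂ] stdOrthonormalBasis ℂ H i

theorem marginallyCyclic_maxEntangled : MarginallyCyclic (maxEntangled H) := by
  let e := stdOrthonormalBasis ℂ H
  intro η
  induction η with
  | zero => exact ⟨0, by simp⟩
  | add η₁ η₂ h₁ h₂ =>
    obtain ⟨a₁, rfl⟩ := h₁
    obtain ⟨a₂, rfl⟩ := h₂
    exact ⟨a₁ + a₂, by rw [TensorProduct.mapL_add_left, add_apply]⟩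
  | tmul x y =>
    refine ⟨∑ i, ⟪e i, y⟫_ℂ • InnerProductSpace.rankOne ℂ x (e i), ?_⟩
    rw [maxEntangled, map_sum]
    conv_rhs => rw [← e.sum_repr' y, TensorProduct.tmul_sum]
    refine Finset.sum_congr rfl fun i _ => ?_
    rw [TensorProduct.mapL_tmul, sum_apply, Finset.sum_eq_single i]
    · have hi : ⟪e i, e i⟫_ℂ = 1 := by simp [inner_self_eq_norm_sq_to_K]
      change (⟪e i, y⟫_ℂ • (⟪e i, e i⟫_ℂ • x)) ⊗ₜ[ℂ] e i = _
      rw [hi, one_smul, TensorProduct.smul_tmul]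
    · intro j _ hj
      change ⟪e j, y⟫_ℂ • (⟪e j, e i⟫_ℂ • x) = 0
      rw [e.inner_eq_zero hj, zero_smul, smul_zero]
    · simp

theorem MarginallyCyclic.smul {ξ : H ⊗[ℂ] H} (h : MarginallyCyclic ξ) {c : ℂ} (hc : c ≠ 0) :
    MarginallyCyclic (c • ξ) := by
  intro η
  obtain ⟨a, ha⟩ := h (c⁻¹ • η)
  exact ⟨a, by rw [map_smul, ha, smul_smul, mul_inv_cancel₀ hc, one_smul]⟩

/-- A marginally cyclic vector is separating for the second leg, because `(a ⊗ 1) ξ` runs through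
`H ⊗ H` and `1 ⊗ c` commutes with `a ⊗ 1`. -/
theorem MarginallyCyclic.eq_zero_of_mapL_right {ξ : H ⊗[ℂ] H} (h : MarginallyCyclic ξ)
    {c : H →L[ℂ] H} (hc : TensorProduct.mapL (1 : H →L[ℂ] H) c ξ = 0) : c = 0 := by
  have h0 : ∀ ζ : H ⊗[ℂ] H, TensorProduct.mapL (1 : H →L[ℂ] H) c ζ = 0 := by
    intro ζ
    obtain ⟨a, rfl⟩ := h ζ
    rw [← ContinuousLinearMap.comp_apply, ← TensorProduct.mapL_comp]
    change TensorProduct.mapL (a ∘L 1) (ContinuousLinearMap.id ℂ H ∘L c) ξ = 0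
    rw [TensorProduct.mapL_comp, ContinuousLinearMap.comp_apply, hc, map_zero]
  ext y
  have h2 : (0 : H ⊗[ℂ] H) = y ⊗ₜ[ℂ] c y := (h0 (y ⊗ₜ y)).symm
  have hn := TensorProduct.norm_tmul (𝕜 := ℂ) y (c y)
  rw [← h2, norm_zero] at hn
  rcases mul_eq_zero.mp hn.symm with hy | hy
  · rw [norm_eq_zero.mp hy, map_zero, zero_apply]
  · exact norm_eq_zero.mp hy

/-- A marginally cyclic vector is also cyclic for the second leg: `c ↦ (1 ⊗ c) ξ` is injective,
and hence surjective by a dimension count. -/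
theorem MarginallyCyclic.exists_mapL_right {ξ : H ⊗[ℂ] H} (h : MarginallyCyclic ξ)
    (η : H ⊗[ℂ] H) : ∃ c : H →L[ℂ] H, TensorProduct.mapL (1 : H →L[ℂ] H) c ξ = η := by
  let T : (H →ₗ[ℂ] H) →ₗ[ℂ] H ⊗[ℂ] H :=
    { toFun := fun c => TensorProduct.map LinearMap.id c ξ
      map_add' := fun c d => by rw [TensorProduct.map_add_right, LinearMap.add_apply]
      map_smul' := fun c d => by
        rw [TensorProduct.map_smul_right, LinearMap.smul_apply, RingHom.id_apply] }
  have hT : ∀ c : H →ₗ[ℂ] H,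
      TensorProduct.mapL (1 : H →L[ℂ] H) (LinearMap.toContinuousLinearMap c) ξ = T c := by
    intro c
    rw [TensorProduct.mapL_apply]
    rfl
  have hinj : Function.Injective T := by
    rw [← LinearMap.ker_eq_bot, LinearMap.ker_eq_bot']
    intro c hc
    exact LinearMap.toContinuousLinearMap.map_eq_zero_iff.mp
      (h.eq_zero_of_mapL_right ((hT c).trans hc))
  have hsurj : Function.Surjective T :=
    (LinearMap.injective_iff_surjective_of_finrank_eq_finrank
      (by rw [Module.finrank_linearMap, Module.finrank_tensorProduct])).mp hinj
  obtain ⟨c, hc⟩ := hsurj η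
  exact ⟨LinearMap.toContinuousLinearMap c, (hT c).trans hc⟩

end PulledState

/-! ### Entanglement preservation at a single vector, and the range of a separable state -/

/-- The functional `ρ_ξ` as an element of the normed space of functionals on `B(K ⊗ H)`. -/
def pulledForm (φ : (K →L[ℂ] K) →L[ℂ] (H →L[ℂ] H)) (ξ : H ⊗[ℂ] H) : Functional (K ⊗[ℂ] H) :=
  LinearMap.toContinuousLinearMap (pulledVectorState φ ξ)

theorem pulledForm_mapL (φ : (K →L[ℂ] K) →L[ℂ] (H →L[ℂ] H)) (ξ : H ⊗[ℂ] H) (a : K →L[ℂ] K)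
    (b : H →L[ℂ] H) :
    pulledForm φ ξ (TensorProduct.mapL a b) = ⟪ξ, TensorProduct.mapL (φ a) b ξ⟫_ℂ := by
  change ⟪ξ, inflation _ _ ξ⟫_ℂ = _
  rw [inflation_mapL]

theorem pulledForm_one {φ : (K →L[ℂ] K) →L[ℂ] (H →L[ℂ] H)} (hφ : φ 1 = 1) {ξ : H ⊗[ℂ] H}
    (hξ : ‖ξ‖ = 1) : pulledForm φ ξ 1 = 1 := by
  rw [← mapL_one_one, pulledForm_mapL, hφ, mapL_one_one]
  refine (inner_self_eq_norm_sq_to_K (𝕜 := ℂ) ξ).trans ?_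
  rw [hξ]
  simp

theorem isState_pulledVectorState {r : ℕ} {v : Fin r → H →L[ℂ] K} (hv : krausMap v 1 = 1)
    {ξ : H ⊗[ℂ] H} (hξ : ‖ξ‖ = 1) : IsState (pulledVectorState (krausMap v) ξ) := by
  refine ⟨fun x hx => ?_, pulledForm_one hv hξ⟩
  rw [pulledVectorState_krausMap, ContinuousLinearMap.coe_coe, sum_apply]
  exact Finset.sum_nonneg fun i _ => vecForm_nonneg _ hx

theorem functional_ext {ω ω' : Functional (K ⊗[ℂ] H)}
    (h : ∀ a b, ω (TensorProduct.mapL a b) = ω' (TensorProduct.mapL a b)) : ω = ω' :=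
  ContinuousLinearMap.coe_injective (functional_ext_mapL h)

theorem pulledForm_krausMap {r : ℕ} (v : Fin r → H →L[ℂ] K) (ξ : H ⊗[ℂ] H) :
    pulledForm (krausMap v) ξ =
      ∑ i, vecForm (TensorProduct.mapL (v i) (1 : H →L[ℂ] H) ξ) :=
  ContinuousLinearMap.coe_injective (pulledVectorState_krausMap v ξ)

theorem continuous_pulledForm (ξ : H ⊗[ℂ] H) :
    Continuous fun φ : (K →L[ℂ] K) →L[ℂ] (H →L[ℂ] H) => pulledForm φ ξ := by
  have : FiniteDimensional ℂ ((K →L[ℂ] K) →L[ℂ] (H →L[ℂ] H)) := inferInstance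
  refine continuous_clm_apply.mpr fun x => ?_
  induction x using mapL_induction with
  | h a b =>
    let T : ((K →L[ℂ] K) →L[ℂ] (H →L[ℂ] H)) →ₗ[ℂ] ℂ :=
      { toFun := fun φ => ⟪ξ, TensorProduct.mapL (φ a) b ξ⟫_ℂ
        map_add' := fun φ ψ => by
          rw [add_apply, TensorProduct.mapL_add_left, add_apply, inner_add_right]
        map_smul' := fun c φ => by
          rw [smul_apply, TensorProduct.mapL_smul_left, smul_apply]
          exact inner_smul_right _ _ _ }
    convert T.continuous_of_finiteDimensional using 1
    funext φ
    exact pulledForm_mapL φ ξ a b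
  | hadd x y hx hy =>
    simp only [map_add]
    exact hx.add hy

/-- Separability of `ρ_ξ` passes to `ρ_{(1 ⊗ c) ξ}`: a product vector `x ⊗ y` in the decomposition
is replaced by `x ⊗ c y`. -/
theorem pulledForm_mapL_mem_sepStates [Nontrivial H] [Nontrivial K]
    {φ : (K →L[ℂ] K) →L[ℂ] (H →L[ℂ] H)} (hφ : φ 1 = 1) {ξ : H ⊗[ℂ] H}
    (h : pulledForm φ ξ ∈ sepStates H K) (c : H →L[ℂ] H)
    (hc : ‖TensorProduct.mapL (1 : H →L[ℂ] H) c ξ‖ = 1) :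
    pulledForm φ (TensorProduct.mapL (1 : H →L[ℂ] H) c ξ) ∈ sepStates H K := by
  obtain ⟨N, x, y, hxy⟩ := exists_sum_of_mem_sepStates h
  refine mem_sepStates_of_sum x (fun i => c (y i)) (functional_ext fun a b => ?_)
    (pulledForm_one hφ hc)
  have h1 : pulledForm φ (TensorProduct.mapL (1 : H →L[ℂ] H) c ξ) (TensorProduct.mapL a b) =
      pulledForm φ ξ (TensorProduct.mapL a (ContinuousLinearMap.adjoint c ∘L b ∘L c)) := by
    have hcomp : TensorProduct.mapL (φ a) (ContinuousLinearMap.adjoint c ∘L b ∘L c) =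
        TensorProduct.mapL (1 : H →L[ℂ] H) (ContinuousLinearMap.adjoint c) ∘L
          TensorProduct.mapL (φ a) b ∘L TensorProduct.mapL (1 : H →L[ℂ] H) c := by
      rw [← TensorProduct.mapL_comp, ← TensorProduct.mapL_comp]
      rfl
    rw [pulledForm_mapL, pulledForm_mapL, hcomp, ContinuousLinearMap.comp_apply,
      inner_mapL_adjoint _ _ ξ, ContinuousLinearMap.adjoint_adjoint,
      ← ContinuousLinearMap.star_eq_adjoint, star_one, ContinuousLinearMap.comp_apply]
  rw [h1, hxy, sum_apply, sum_apply]
  refine Finset.sum_congr rfl fun i _ => ?_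
  rw [vecForm_tmul, vecForm_tmul]
  simp [ContinuousLinearMap.adjoint_inner_right]

variable (H) in
theorem exists_marginallyCyclic [Nontrivial H] : ∃ ξ : H ⊗[ℂ] H, ‖ξ‖ = 1 ∧ MarginallyCyclic ξ := by
  have hne : ‖maxEntangled H‖ ≠ 0 := by
    intro h0
    obtain ⟨u, hu⟩ := exists_norm_eq H zero_le_one
    obtain ⟨a, ha⟩ := marginallyCyclic_maxEntangled (u ⊗ₜ[ℂ] u)
    rw [norm_eq_zero.mp h0, map_zero] at ha
    have hn := TensorProduct.norm_tmul (𝕜 := ℂ) u u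
    rw [← ha, norm_zero, hu] at hn
    norm_num at hn
  refine ⟨((‖maxEntangled H‖⁻¹ : ℝ) : ℂ) • maxEntangled H, ?_,
    marginallyCyclic_maxEntangled.smul ?_⟩
  · rw [norm_smul, Complex.norm_real, norm_inv, norm_norm, inv_mul_cancel₀ hne]
  · simpa using hne

/-- Preservation of entanglement can be tested on a single marginally cyclic unit vector. -/
theorem preservesEntanglement_krausMap_iff [Nontrivial H] [Nontrivial K] {r : ℕ}
    {v : Fin r → H →L[ℂ] K} (hv : krausMap v 1 = 1) {ξ : H ⊗[ℂ] H} (hξ : ‖ξ‖ = 1)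
    (hc : MarginallyCyclic ξ) :
    PreservesEntanglement (krausMap v) ↔ pulledForm (krausMap v) ξ ∉ sepStates H K := by
  constructor
  · intro h hsep
    exact (h ξ hξ hc).2 (isSeparable_iff.mpr hsep)
  · intro h η hη hηc
    refine ⟨isState_pulledVectorState hv hη, fun hsep => h ?_⟩
    obtain ⟨c, rfl⟩ := hηc.exists_mapL_right ξ
    exact pulledForm_mapL_mem_sepStates hv (isSeparable_iff.mp hsep) c hξ

/-- The range of the density operator of a separable state is spanned by product vectors. -/
theorem tmul_mem_span_of_sum_eq {ι κ : Type*} [Fintype ι] [Fintype κ] {L : Type*}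
    [NormedAddCommGroup L] [InnerProductSpace ℂ L] [FiniteDimensional ℂ L]
    {z : ι → L} {w : κ → L} (h : ∑ i, vecForm (z i) = ∑ j, vecForm (w j)) (j : κ) :
    w j ∈ Submodule.span ℂ (Set.range z) := by
  rw [← Submodule.orthogonal_orthogonal (Submodule.span ℂ (Set.range z)),
    Submodule.mem_orthogonal]
  intro u hu
  have hz : ∀ i, ⟪u, z i⟫_ℂ = 0 := fun i =>
    Submodule.inner_left_of_mem_orthogonal (Submodule.subset_span (Set.mem_range_self i)) hu
  have h1 := congrArg (fun ω : Functional L => ω (InnerProductSpace.rankOne ℂ u u)) h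
  simp only [sum_apply, vecForm_rankOne, hz] at h1
  have h2 : ∑ j, ‖⟪u, w j⟫_ℂ‖ ^ 2 = 0 := by
    have : ((∑ j, ‖⟪u, w j⟫_ℂ‖ ^ 2 : ℝ) : ℂ) = 0 := by
      rw [Complex.ofReal_sum, ← h1]
      simp
    exact_mod_cast this
  have h3 := (Finset.sum_eq_zero_iff_of_nonneg fun j _ => sq_nonneg _).mp h2 j (Finset.mem_univ j)
  exact norm_eq_zero.mp (pow_eq_zero_iff two_ne_zero |>.mp h3)

/-- If `ρ_ξ` is a sum of product vector functionals, then the second factors with nonzero first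
factor span `H`. -/
theorem MarginallyCyclic.eq_zero_of_inner_eq_zero {φ : (K →L[ℂ] K) →L[ℂ] (H →L[ℂ] H)}
    (hφ : φ 1 = 1) {ξ : H ⊗[ℂ] H} (hc : MarginallyCyclic ξ) {N : ℕ} {x : Fin N → K}
    {y : Fin N → H} (hxy : pulledForm φ ξ = ∑ i, vecForm (x i ⊗ₜ[ℂ] y i)) {h : H}
    (hh : ∀ i, x i ≠ 0 → ⟪h, y i⟫_ℂ = 0) : h = 0 := by
  let b : H →L[ℂ] H := InnerProductSpace.rankOne ℂ h h
  have h1 : ⟪ξ, TensorProduct.mapL (1 : H →L[ℂ] H) b ξ⟫_ℂ = 0 := by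
    rw [← hφ, ← pulledForm_mapL, hxy, sum_apply]
    refine Finset.sum_eq_zero fun i _ => ?_
    rw [vecForm_tmul]
    rcases eq_or_ne (x i) 0 with hx | hx
    · simp [hx]
    · rw [vecForm_rankOne, hh i hx]
      simp
  have h2 : ⟪TensorProduct.mapL (1 : H →L[ℂ] H) b ξ, TensorProduct.mapL (1 : H →L[ℂ] H) b ξ⟫_ℂ =
      0 := by
    have hbb : TensorProduct.mapL (1 : H →L[ℂ] H) b (TensorProduct.mapL (1 : H →L[ℂ] H) b ξ) =
        ⟪h, h⟫_ℂ • TensorProduct.mapL (1 : H →L[ℂ] H) b ξ := by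
      rw [← ContinuousLinearMap.comp_apply, ← TensorProduct.mapL_comp,
        InnerProductSpace.rankOne_comp_rankOne, TensorProduct.mapL_smul_right, smul_apply]
      rfl
    have hadj := inner_mapL_adjoint (1 : H →L[ℂ] H) b ξ (TensorProduct.mapL (1 : H →L[ℂ] H) b ξ)
    rw [← ContinuousLinearMap.star_eq_adjoint, star_one, InnerProductSpace.adjoint_rankOne,
      hbb] at hadj
    rw [← hadj]
    refine (inner_smul_right (𝕜 := ℂ) ξ (TensorProduct.mapL (1 : H →L[ℂ] H) b ξ) ⟪h, h⟫_ℂ).trans ?_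
    rw [h1, mul_zero]
  have h3 : b = 0 := hc.eq_zero_of_mapL_right (inner_self_eq_zero.mp h2)
  simpa [b] using h3

/-- A unital map with fewer than `dim H` Kraus operators preserves entanglement. If `ρ_ξ` were a sum
of product vector functionals given by `xⱼ ⊗ yⱼ`, then these product vectors would lie in the span
of the `r` vectors `(vᵢ ⊗ 1) ξ`. A slice map `f ⊗ 1` with `f xⱼ ≠ 0` whenever `xⱼ ≠ 0` maps that
span onto the span of the `yⱼ`, which is `H`. -/
theorem preservesEntanglement_krausMap_of_lt [Nontrivial H] [Nontrivial K] {r : ℕ}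
    (hr : r < Module.finrank ℂ H) {v : Fin r → H →L[ℂ] K} (hv : krausMap v 1 = 1) :
    PreservesEntanglement (krausMap v) := by
  obtain ⟨ξ, hξ, hc⟩ := exists_marginallyCyclic H
  rw [preservesEntanglement_krausMap_iff hv hξ hc]
  intro hsep
  obtain ⟨N, x, y, hxy⟩ := exists_sum_of_mem_sepStates hsep
  let z : Fin r → K ⊗[ℂ] H := fun i => TensorProduct.mapL (v i) (1 : H →L[ℂ] H) ξ
  have hmem : ∀ j, x j ⊗ₜ[ℂ] y j ∈ Submodule.span ℂ (Set.range z) :=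
    tmul_mem_span_of_sum_eq ((pulledForm_krausMap v ξ).symm.trans hxy)
  obtain ⟨f, hf⟩ := Module.exists_dual_forall_apply_ne_zero (K := ℂ)
    (fun j : {j // x j ≠ 0} => x j) fun j => j.2
  let T : K ⊗[ℂ] H →ₗ[ℂ] H := (TensorProduct.lid ℂ H).toLinearMap ∘ₗ LinearMap.rTensor H f
  have htop : (Submodule.span ℂ (Set.range z)).map T = ⊤ := by
    rw [← Submodule.orthogonal_eq_bot_iff, Submodule.eq_bot_iff]
    intro h hh
    refine hc.eq_zero_of_inner_eq_zero hv hxy fun j hj => ?_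
    have h1 : ⟪h, T (x j ⊗ₜ[ℂ] y j)⟫_ℂ = 0 :=
      Submodule.inner_left_of_mem_orthogonal (Submodule.mem_map_of_mem (hmem j)) hh
    have h2 : T (x j ⊗ₜ[ℂ] y j) = f (x j) • y j := by simp [T]
    rw [h2, inner_smul_right] at h1
    exact (mul_eq_zero.mp h1).resolve_left (hf ⟨j, hj⟩)
  have h1 : Module.finrank ℂ H ≤ Module.finrank ℂ (Submodule.span ℂ (Set.range z)) := by
    rw [← finrank_top ℂ H, ← htop]
    exact Submodule.finrank_map_le _ _
  have h2 := finrank_range_le_card (R := ℂ) z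
  rw [Set.finrank, Fintype.card_fin] at h2
  omega

/-! ### Entanglement breaking maps -/

section Slice

/-- The slice map `⟨u| ⊗ 1 : H ⊗ H → H`. -/
def sliceMap (u : H) : H ⊗[ℂ] H →ₗ[ℂ] H :=
  (TensorProduct.lid ℂ H).toLinearMap ∘ₗ LinearMap.rTensor H (innerSL ℂ u).toLinearMap

theorem sliceMap_tmul (u x y : H) : sliceMap u (x ⊗ₜ[ℂ] y) = ⟪u, x⟫_ℂ • y := by
  simp [sliceMap]

theorem inner_mapL_rankOne (u : H) (b : H →L[ℂ] H) (ξ η : H ⊗[ℂ] H) :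
    ⟪ξ, TensorProduct.mapL (InnerProductSpace.rankOne ℂ u u) b η⟫_ℂ =
      ⟪sliceMap u ξ, b (sliceMap u η)⟫_ℂ := by
  induction ξ with
  | zero => simp
  | add ξ₁ ξ₂ h₁ h₂ => rw [inner_add_left, h₁, h₂, map_add, inner_add_left]
  | tmul x y =>
    induction η with
    | zero => simp
    | add η₁ η₂ h₁ h₂ => rw [map_add, inner_add_right, h₁, h₂, map_add, map_add, inner_add_right]
    | tmul z w =>
      rw [TensorProduct.mapL_tmul, TensorProduct.inner_tmul, sliceMap_tmul, sliceMap_tmul,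
        map_smul, inner_smul_left, inner_smul_right, inner_conj_symm,
        InnerProductSpace.rankOne_apply, inner_smul_right]
      ring

/-- A unital map of the form `φ(a) = ∑ ⟨x_α, a x_α⟩ T_α` with positive operators `T_α` is
entanglement breaking. -/
theorem pulledForm_mem_sepStates_of_eq_sum [Nontrivial H] [Nontrivial K]
    {φ : (K →L[ℂ] K) →L[ℂ] (H →L[ℂ] H)} (hφ : φ 1 = 1) {ι : Type*} [Fintype ι] (x : ι → K)
    (T : ι → H →L[ℂ] H) (hT : ∀ i, (T i).IsPositive) (h : ∀ a, φ a = ∑ i, vecForm (x i) a • T i)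
    {ξ : H ⊗[ℂ] H} (hξ : ‖ξ‖ = 1) : pulledForm φ ξ ∈ sepStates H K := by
  choose N u hu using fun i => ContinuousLinearMap.isPositive_iff_eq_sum_rankOne.mp (hT i)
  refine mem_sepStates_of_sum (ι := Σ i, Fin (N i)) (fun p => x p.1)
    (fun p => sliceMap (u p.1 p.2) ξ) (functional_ext fun a b => ?_) (pulledForm_one hφ hξ)
  have ha : φ a = ∑ p : Σ i, Fin (N i),
      vecForm (x p.1) a • InnerProductSpace.rankOne ℂ (u p.1 p.2) (u p.1 p.2) := by
    rw [h, Fintype.sum_sigma]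
    refine Finset.sum_congr rfl fun i _ => ?_
    conv_lhs => rw [hu i]
    rw [Finset.smul_sum]
  rw [pulledForm_mapL, ha, mapL_sum_left, sum_apply, inner_sum, sum_apply]
  refine Finset.sum_congr rfl fun p _ => ?_
  rw [vecForm_tmul, TensorProduct.mapL_smul_left, smul_apply]
  refine (inner_smul_right (𝕜 := ℂ) _ _ _).trans ?_
  rw [inner_mapL_rankOne, vecForm_apply (sliceMap _ _)]

end Slice

/-! ### Polarization in `B(K)` -/

section Polarization

/-- The vectors `eᵢ + iᵏ eⱼ` of the polarization identity. -/
def polVec {m : ℕ} (e : OrthonormalBasis (Fin m) ℂ K) (p : Fin m × Fin m × Fin 4) : K :=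
  e p.1 + Complex.I ^ (p.2.2 : ℕ) • e p.2.1

/-- The operators `4⁻¹ i⁻ᵏ |eᵢ⟩⟨eⱼ|` dual to the vector functionals of `polVec`. -/
def polOp {m : ℕ} (e : OrthonormalBasis (Fin m) ℂ K) (p : Fin m × Fin m × Fin 4) : K →L[ℂ] K :=
  (4⁻¹ * (-Complex.I) ^ (p.2.2 : ℕ)) • InnerProductSpace.rankOne ℂ (e p.1) (e p.2.1)

theorem vecForm_polVec {m : ℕ} (e : OrthonormalBasis (Fin m) ℂ K) (a : K →L[ℂ] K) (i j : Fin m)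
    (k : Fin 4) : vecForm (polVec e (i, j, k)) a =
      ⟪e i, a (e i)⟫_ℂ + Complex.I ^ (k : ℕ) * ⟪e i, a (e j)⟫_ℂ +
        (-Complex.I) ^ (k : ℕ) * ⟪e j, a (e i)⟫_ℂ + ⟪e j, a (e j)⟫_ℂ := by
  have hI : (-Complex.I) ^ (k : ℕ) * Complex.I ^ (k : ℕ) = 1 := by
    rw [← mul_pow]; simp
  simp only [vecForm_apply, polVec, map_add, map_smul, inner_add_left, inner_add_right,
    inner_smul_left, inner_smul_right, map_pow, Complex.conj_I]
  linear_combination ⟪e j, a (e j)⟫_ℂ * hI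

/-- Polarization: for fixed `i` and `j`, the sum over `k` of `4⁻¹ i⁻ᵏ ⟨x, a x⟩` with
`x = eᵢ + iᵏ eⱼ` isolates the matrix entry `⟨eᵢ, a eⱼ⟩`. -/
theorem sum_polOp {m : ℕ} (e : OrthonormalBasis (Fin m) ℂ K) (a : K →L[ℂ] K) :
    a = ∑ p, vecForm (polVec e p) a • polOp e p := by
  have h1 : a = ∑ i, ∑ j, ⟪e i, a (e j)⟫_ℂ • InnerProductSpace.rankOne ℂ (e i) (e j) := by
    ext x
    conv_lhs => rw [← e.sum_repr' x, map_sum]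
    rw [Finset.sum_comm, sum_apply]
    refine Finset.sum_congr rfl fun j _ => ?_
    rw [map_smul, sum_apply]
    conv_lhs => rw [← e.sum_repr' (a (e j)), Finset.smul_sum]
    refine Finset.sum_congr rfl fun i _ => ?_
    rw [smul_apply, InnerProductSpace.rankOne_apply, smul_comm]
  conv_lhs => rw [h1]
  rw [Fintype.sum_prod_type]
  refine Finset.sum_congr rfl fun i _ => ?_
  rw [Fintype.sum_prod_type]
  refine Finset.sum_congr rfl fun j _ => ?_
  simp only [polOp, smul_smul, ← Finset.sum_smul, vecForm_polVec]
  congr 1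
  simp only [Fin.sum_univ_four, Fin.val_zero, Fin.val_one, Fin.val_two,
    show ((3 : Fin 4) : ℕ) = 3 from rfl]
  ring_nf
  simp [Complex.I_sq, Complex.I_pow_four, show Complex.I ^ 6 = -1 by
    rw [show 6 = 4 + 2 by rfl, pow_add]; simp]
  ring

/-- The off-diagonal terms cancel in the unweighted sum, which is a multiple of the trace. -/
theorem sum_vecForm_polVec {m : ℕ} (e : OrthonormalBasis (Fin m) ℂ K) (a : K →L[ℂ] K) :
    ∑ p, vecForm (polVec e p) a = 8 * m * ∑ i, ⟪e i, a (e i)⟫_ℂ := by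
  have h1 : ∀ i j, ∑ k, vecForm (polVec e (i, j, k)) a =
      4 * ⟪e i, a (e i)⟫_ℂ + 4 * ⟪e j, a (e j)⟫_ℂ := by
    intro i j
    simp only [vecForm_polVec, Fin.sum_univ_four, Fin.val_zero, Fin.val_one, Fin.val_two,
      show ((3 : Fin 4) : ℕ) = 3 from rfl]
    ring_nf
    simp [Complex.I_sq]
    ring
  simp only [Fintype.sum_prod_type, h1, Finset.sum_add_distrib, ← Finset.mul_sum,
    Finset.sum_const, Finset.card_univ, Fintype.card_fin, nsmul_eq_mul]
  ring

end Polarization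

/-! ### A neighborhood of the completely depolarizing map -/

section Depolarizing

theorem krausMap_star {r : ℕ} (v : Fin r → H →L[ℂ] K) (a : K →L[ℂ] K) :
    krausMap v (star a) = star (krausMap v a) := by
  simp [krausMap_apply, ContinuousLinearMap.star_eq_adjoint,
    ContinuousLinearMap.adjoint_comp, ContinuousLinearMap.comp_assoc]

theorem vecForm_star (x : K) (a : K →L[ℂ] K) : vecForm x (star a) = star (vecForm x a) := by
  rw [vecForm_apply, ContinuousLinearMap.star_eq_adjoint, ContinuousLinearMap.adjoint_inner_right,
    vecForm_apply]
  exact (inner_conj_symm _ _).symm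

/-- The Kraus operators `m^(-1/2) |eᵢ⟩⟨fⱼ|` of the completely depolarizing map. -/
def depolarizing {m n : ℕ} (e : OrthonormalBasis (Fin m) ℂ K) (f : OrthonormalBasis (Fin n) ℂ H)
    (q : Fin (m * n)) : H →L[ℂ] K :=
  (((√m)⁻¹ : ℝ) : ℂ) • InnerProductSpace.rankOne ℂ (e (finProdFinEquiv.symm q).1)
    (f (finProdFinEquiv.symm q).2)

theorem krausMap_depolarizing {m n : ℕ} (e : OrthonormalBasis (Fin m) ℂ K)
    (f : OrthonormalBasis (Fin n) ℂ H) (a : K →L[ℂ] K) :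
    krausMap (depolarizing e f) a = ((m : ℂ)⁻¹ * ∑ i, ⟪e i, a (e i)⟫_ℂ) • (1 : H →L[ℂ] H) := by
  have hm : (((√m)⁻¹ : ℝ) : ℂ) * (((√m)⁻¹ : ℝ) : ℂ) = (m : ℂ)⁻¹ := by
    rw [← Complex.ofReal_mul, ← mul_inv, Real.mul_self_sqrt (Nat.cast_nonneg m)]
    simp
  rw [krausMap_apply, ← finProdFinEquiv.sum_comp, Fintype.sum_prod_type, Finset.mul_sum,
    Finset.sum_smul]
  refine Finset.sum_congr rfl fun i _ => ?_
  have hone : (1 : H →L[ℂ] H) = ∑ j, InnerProductSpace.rankOne ℂ (f j) (f j) :=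
    f.sum_rankOne_eq_id.symm
  rw [hone, Finset.smul_sum]
  refine Finset.sum_congr rfl fun j _ => ?_
  simp only [depolarizing, Equiv.symm_apply_apply, map_smulₛₗ, InnerProductSpace.adjoint_rankOne,
    Complex.conj_ofReal]
  ext x
  simp only [ContinuousLinearMap.comp_apply, smul_apply, InnerProductSpace.rankOne_apply, map_smul,
    smul_smul]
  congr 1
  rw [← hm]
  ring

/-- A neighborhood of the completely depolarizing map `φ₀(a) = m⁻¹ tr(a) 1` consists of entanglement
breaking maps. By polarization `φ(a) = ∑ ⟨x_α, a x_α⟩ T_α` with `T_α = (8m²)⁻¹ + (φ - φ₀)(b_α)`,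
where the `x_α` are the vectors `polVec` and the `b_α` the dual operators `polOp`. -/
theorem pulledForm_mem_sepStates_of_near [Nontrivial H] [Nontrivial K] {m n r : ℕ}
    (hm0 : m ≠ 0) (e : OrthonormalBasis (Fin m) ℂ K) (f : OrthonormalBasis (Fin n) ℂ H)
    {v : Fin r → H →L[ℂ] K} (hv : krausMap v 1 = 1)
    (hnear : ∀ p, ‖(krausMap v - krausMap (depolarizing e f)) (polOp e p)‖ <
      (8 * (m : ℝ) ^ 2)⁻¹) {ξ : H ⊗[ℂ] H} (hξ : ‖ξ‖ = 1) :
    pulledForm (krausMap v) ξ ∈ sepStates H K := by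
  let c : ℝ := (8 * (m : ℝ) ^ 2)⁻¹
  let R : Fin m × Fin m × Fin 4 → H →L[ℂ] H := fun p =>
    (krausMap v - krausMap (depolarizing e f)) (polOp e p)
  have hR : ∀ a, (krausMap v - krausMap (depolarizing e f)) a =
      ∑ p, vecForm (polVec e p) a • R p := by
    intro a
    conv_lhs => rw [sum_polOp e a]
    simp only [map_sum, map_smul, R]
  -- The difference of the maps preserves adjoints, so the coefficients can be taken self-adjoint.
  have hRstar : ∀ a, (krausMap v - krausMap (depolarizing e f)) a =
      ∑ p, vecForm (polVec e p) a • star (R p) := by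
    intro a
    have h1 : (krausMap v - krausMap (depolarizing e f)) a =
        star ((krausMap v - krausMap (depolarizing e f)) (star a)) := by
      simp only [sub_apply, krausMap_star, star_sub, star_star]
    rw [h1, hR, star_sum]
    refine Finset.sum_congr rfl fun p _ => ?_
    rw [star_smul, vecForm_star, star_star]
  let T : Fin m × Fin m × Fin 4 → H →L[ℂ] H := fun p =>
    (c : ℂ) • 1 + (2⁻¹ : ℂ) • (R p + star (R p))
  refine pulledForm_mem_sepStates_of_eq_sum hv (polVec e) T (fun p => ?_) (fun a => ?_) hξ
  · rw [ContinuousLinearMap.isPositive_def']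
    constructor
    · rw [IsSelfAdjoint]
      simp [T, add_comm]
    · intro x
      have h1 : ⟪T p x, x⟫_ℂ = c * (‖x‖ : ℂ) ^ 2 + 2⁻¹ * (⟪R p x, x⟫_ℂ + ⟪x, R p x⟫_ℂ) := by
        simp [T, inner_self_eq_norm_sq_to_K, ContinuousLinearMap.star_eq_adjoint,
          ContinuousLinearMap.adjoint_inner_left]
        ring
      have h2 : ‖⟪R p x, x⟫_ℂ‖ ≤ c * ‖x‖ ^ 2 := by
        calc ‖⟪R p x, x⟫_ℂ‖ ≤ ‖R p x‖ * ‖x‖ := norm_inner_le_norm _ _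
          _ ≤ (‖R p‖ * ‖x‖) * ‖x‖ := by gcongr; exact (R p).le_opNorm x
          _ ≤ (c * ‖x‖) * ‖x‖ := by gcongr; exact (hnear p).le
          _ = c * ‖x‖ ^ 2 := by ring
      have h3 := (abs_le.mp ((Complex.abs_re_le_norm _).trans h2)).1
      have h4 : (⟪x, R p x⟫_ℂ).re = (⟪R p x, x⟫_ℂ).re := inner_re_symm (𝕜 := ℂ) x (R p x)
      rw [ContinuousLinearMap.reApplyInnerSelf_apply, h1]
      have h5 : RCLike.re ((c : ℂ) * (‖x‖ : ℂ) ^ 2 + 2⁻¹ * (⟪R p x, x⟫_ℂ + ⟪x, R p x⟫_ℂ)) =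
          c * ‖x‖ ^ 2 + 2⁻¹ * ((⟪R p x, x⟫_ℂ).re + (⟪x, R p x⟫_ℂ).re) := by
        simp [← Complex.ofReal_pow]
      rw [h5, h4]
      linarith
  · have h1 : krausMap v a = krausMap (depolarizing e f) a +
        (2⁻¹ : ℂ) • ((krausMap v - krausMap (depolarizing e f)) a +
          (krausMap v - krausMap (depolarizing e f)) a) := by
      rw [← two_smul ℂ, smul_smul, sub_apply]
      simp
    have h2 : krausMap (depolarizing e f) a = ∑ p, vecForm (polVec e p) a • (c : ℂ) • 1 := by
      rw [krausMap_depolarizing, ← Finset.sum_smul, sum_vecForm_polVec, smul_smul]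
      congr 1
      have : (m : ℂ) ≠ 0 := by exact_mod_cast hm0
      simp only [c]
      push_cast
      field_simp
    rw [h1]
    nth_rewrite 1 [hR a]
    rw [hRstar a, h2, ← Finset.sum_add_distrib, Finset.smul_sum, ← Finset.sum_add_distrib]
    refine Finset.sum_congr rfl fun p _ => ?_
    simp only [T, smul_add, smul_comm (2⁻¹ : ℂ)]

end Depolarizing

/-! ### Transitivity of the unitary action and positivity of the measures -/

section Transitive

variable {r : ℕ}

/-- The isometry `h ↦ (v₁ h, …, v_r h)` of `H` into `K ⊕ ⋯ ⊕ K` given by a point of `V^r(H,K)`. -/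
def paramIsometry (v : ParamSpace H K r) : H →ₗᵢ[ℂ] PiLp 2 fun _ : Fin r => K where
  toFun h := WithLp.toLp 2 fun i => v.1 i h
  map_add' x y := by ext i; simp
  map_smul' c x := by ext i; simp
  norm_map' h := by
    have hv : ∑ i, (ContinuousLinearMap.adjoint (v.1 i)) ∘L (v.1 i) = 1 := v.2
    have h1 : ((∑ i, ‖v.1 i h‖ ^ 2 : ℝ) : ℂ) = ((‖h‖ ^ 2 : ℝ) : ℂ) := by
      rw [← vecForm_one, ← hv, map_sum, Complex.ofReal_sum]
      refine Finset.sum_congr rfl fun i _ => ?_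
      rw [vecForm_apply, ContinuousLinearMap.comp_apply, ContinuousLinearMap.adjoint_inner_right,
        inner_self_eq_norm_sq_to_K]
      simp
    change ‖(WithLp.toLp 2 fun i => v.1 i h : PiLp 2 fun _ : Fin r => K)‖ = ‖h‖
    rw [PiLp.norm_eq_of_L2, Complex.ofReal_injective h1, Real.sqrt_sq (norm_nonneg h)]

/-- The `(i, j)` entry of an operator on `K ⊕ ⋯ ⊕ K`. -/
def blockEntry (U : (PiLp 2 fun _ : Fin r => K) →ₗ[ℂ] (PiLp 2 fun _ : Fin r => K)) (i j : Fin r) :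
    K →L[ℂ] K :=
  LinearMap.toContinuousLinearMap
    { toFun := fun x => U (WithLp.toLp 2 (Pi.single j x)) i
      map_add' := fun x y => by
        rw [Pi.single_add, WithLp.toLp_add, map_add, PiLp.add_apply]
      map_smul' := fun c x => by
        rw [Pi.single_smul, WithLp.toLp_smul, map_smul, PiLp.smul_apply, RingHom.id_apply] }

theorem blockEntry_apply (U : (PiLp 2 fun _ : Fin r => K) →ₗ[ℂ] (PiLp 2 fun _ : Fin r => K))
    (i j : Fin r) (x : K) : blockEntry U i j x = U (WithLp.toLp 2 (Pi.single j x)) i := rfl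

theorem inner_toLp_single (i : Fin r) (x : K) (z : PiLp 2 fun _ : Fin r => K) :
    ⟪(WithLp.toLp 2 (Pi.single i x) : PiLp 2 fun _ : Fin r => K), z⟫_ℂ = ⟪x, z i⟫_ℂ := by
  rw [PiLp.inner_apply, Finset.sum_eq_single i]
  · simp
  · intro j _ hj
    simp [hj]
  · simp

theorem adjoint_blockEntry
    (U : (PiLp 2 fun _ : Fin r => K) ≃ₗᵢ[ℂ] (PiLp 2 fun _ : Fin r => K)) (i j : Fin r) :
    ContinuousLinearMap.adjoint (blockEntry U.toLinearEquiv.toLinearMap i j) =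
      blockEntry U.symm.toLinearEquiv.toLinearMap j i := by
  symm
  rw [ContinuousLinearMap.eq_adjoint_iff]
  intro x y
  rw [blockEntry_apply, blockEntry_apply, ← inner_conj_symm, ← inner_toLp_single, inner_conj_symm,
    ← inner_toLp_single]
  exact U.symm.inner_map_eq_flip _ _

theorem sum_adjoint_blockEntry
    (U : (PiLp 2 fun _ : Fin r => K) ≃ₗᵢ[ℂ] (PiLp 2 fun _ : Fin r => K)) (i j : Fin r) :
    ∑ k, ContinuousLinearMap.adjoint (blockEntry U.toLinearEquiv.toLinearMap k i) *
      blockEntry U.toLinearEquiv.toLinearMap k j = if i = j then 1 else 0 := by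
  ext y
  refine ext_inner_left ℂ fun x => ?_
  have h1 := U.inner_map_map (WithLp.toLp 2 (Pi.single i x)) (WithLp.toLp 2 (Pi.single j y))
  rw [inner_toLp_single, PiLp.inner_apply] at h1
  rw [sum_apply, inner_sum]
  simp only [mul_apply_eq_comp, ContinuousLinearMap.adjoint_inner_right]
  refine h1.trans ?_
  split_ifs with hij
  · subst hij
    simp
  · simp [hij]

/-- The unitary matrix of a unitary operator on `K ⊕ ⋯ ⊕ K`. -/
def blockUnitary (U : (PiLp 2 fun _ : Fin r => K) ≃ₗᵢ[ℂ] (PiLp 2 fun _ : Fin r => K)) :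
    UnitaryGrp K r :=
  ⟨CStarMatrix.ofMatrix (Matrix.of (blockEntry U.toLinearEquiv.toLinearMap)), by
    rw [Unitary.mem_iff]
    constructor
    · refine CStarMatrix.ext fun i j => ?_
      rw [CStarMatrix.mul_apply, CStarMatrix.one_apply]
      exact sum_adjoint_blockEntry U i j
    · refine CStarMatrix.ext fun i j => ?_
      rw [CStarMatrix.mul_apply, CStarMatrix.one_apply, ← sum_adjoint_blockEntry U.symm i j]
      refine Finset.sum_congr rfl fun k _ => ?_
      rw [adjoint_blockEntry, ← adjoint_blockEntry U]
      rfl⟩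

/-- The unitary group of `B(K ⊕ ⋯ ⊕ K)` acts transitively on `V^r(H,K)`, because an isometry between
subspaces of a finite-dimensional Hilbert space extends to a unitary operator. -/
theorem exists_act_eq (v w : ParamSpace H K r) : ∃ U : UnitaryGrp K r, act U v = w := by
  let L := ((paramIsometry w).comp (paramIsometry v).equivRange.symm.toLinearIsometry).extend
  let U := L.toLinearIsometryEquiv rfl
  refine ⟨blockUnitary U, Subtype.ext (funext fun i => ?_)⟩
  ext h
  have hL : U (paramIsometry v h) = paramIsometry w h := by
    have := ((paramIsometry w).comp
      (paramIsometry v).equivRange.symm.toLinearIsometry).extend_apply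
        ((paramIsometry v).equivRange h)
    refine Eq.trans this ?_
    simp
  have hsum : paramIsometry v h = ∑ j, WithLp.toLp 2 (Pi.single j (v.1 j h)) := by
    ext k
    simp [paramIsometry, Finset.sum_apply, Pi.single_apply]
  have h1 : paramIsometry w h i = w.1 i h := rfl
  rw [← h1, ← hL, hsum, map_sum]
  simp only [act, actTuple, sum_apply, ContinuousLinearMap.comp_apply, WithLp.ofLp_sum,
    Finset.sum_apply]
  rfl

theorem invariantMeasure_pos {O : Set (ParamSpace H K r)} (hO : IsOpen O) (hne : O.Nonempty) :
    0 < invariantMeasure H K r O := by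
  obtain ⟨w, hw⟩ := hne
  have h : Nonempty (ParamSpace H K r) := ⟨w⟩
  rw [invariantMeasure, dif_pos h,
    MeasureTheory.Measure.map_apply (continuous_act _).measurable hO.measurableSet]
  obtain ⟨U, hU⟩ := exists_act_eq h.some w
  have : MeasureTheory.Measure.IsOpenPosMeasure (haarProb K r) := by
    unfold haarProb
    infer_instance
  exact (hO.preimage (continuous_act _)).measure_pos _ ⟨U, by rwa [Set.mem_preimage, hU]⟩

theorem ucpMeasure_pos {O : Set (UCPMaps H K r)} (hO : IsOpen O) {v : ParamSpace H K r}
    (hv : toUCP v ∈ O) : 0 < ucpMeasure H K r O := by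
  rw [ucpMeasure_apply hO.measurableSet]
  exact invariantMeasure_pos (hO.preimage continuous_toUCP) ⟨v, hv⟩

theorem isProbabilityMeasure_ucpMeasure (v : ParamSpace H K r) :
    MeasureTheory.IsProbabilityMeasure (ucpMeasure H K r) :=
  have := isProbabilityMeasure_invariantMeasure ⟨v⟩
  MeasureTheory.Measure.isProbabilityMeasure_map continuous_toUCP.measurable.aemeasurable

end Transitive

/-! ### The set `EP(Φ^r)` -/

section EntanglementPreserving

variable {r : ℕ}

theorem krausMap_one_of_mem {v : Fin r → H →L[ℂ] K} (hv : v ∈ ParamSpace H K r) :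
    krausMap v 1 = 1 := (isUCP_krausMap hv).1

theorem exists_krausMap_eq (φ : UCPMaps H K r) :
    ∃ (s : ℕ) (v : Fin s → H →L[ℂ] K), s ≤ r ∧ φ.1 = krausMap v ∧ krausMap v 1 = 1 := by
  obtain ⟨φ, hφ, s, hs, v, -, rfl⟩ := φ
  exact ⟨s, v, hs, rfl, hφ.1⟩

theorem mem_EP_iff [Nontrivial H] [Nontrivial K] {ξ : H ⊗[ℂ] H} (hξ : ‖ξ‖ = 1)
    (hc : MarginallyCyclic ξ) (φ : UCPMaps H K r) :
    φ ∈ EP H K r ↔ pulledForm φ.1 ξ ∉ sepStates H K := by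
  obtain ⟨s, v, -, h, hv⟩ := exists_krausMap_eq φ
  change PreservesEntanglement φ.1 ↔ _
  rw [h]
  exact preservesEntanglement_krausMap_iff hv hξ hc

theorem isOpen_EP [Nontrivial H] [Nontrivial K] : IsOpen (EP H K r) := by
  obtain ⟨ξ, hξ, hc⟩ := exists_marginallyCyclic H
  have : EP H K r = (fun φ : UCPMaps H K r => pulledForm φ.1 ξ) ⁻¹' (sepStates H K)ᶜ :=
    Set.ext fun φ => mem_EP_iff hξ hc φ
  rw [this]
  exact isCompact_sepStates.isClosed.isOpen_compl.preimage
    ((continuous_pulledForm ξ).comp continuous_subtype_val)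

/-- All UCP maps of rank less than `dim H` preserve entanglement. -/
theorem EP_eq_univ [Nontrivial H] [Nontrivial K] (hr : r < Module.finrank ℂ H) :
    EP H K r = Set.univ := by
  refine Set.eq_univ_of_forall fun φ => ?_
  obtain ⟨s, v, hs, h, hv⟩ := exists_krausMap_eq φ
  change PreservesEntanglement φ.1
  rw [h]
  exact preservesEntanglement_krausMap_of_lt (hs.trans_lt hr) hv

/-- If `dim H ≤ dim K`, then `V^r(H,K)` contains tuples `(v, 0, …, 0)` with an isometry `v`. -/
theorem exists_param_single (hHK : Module.finrank ℂ H ≤ Module.finrank ℂ K) (hr : 1 ≤ r) :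
    ∃ (w : ParamSpace H K r) (v : Fin 1 → H →L[ℂ] K), krausMap w.1 = krausMap v := by
  obtain ⟨r, rfl⟩ := Nat.exists_eq_add_of_le' hr
  let f := stdOrthonormalBasis ℂ H
  let e := stdOrthonormalBasis ℂ K
  let V : H →L[ℂ] K := ∑ j, InnerProductSpace.rankOne ℂ (e (Fin.castLE hHK j)) (f j)
  have hV : ContinuousLinearMap.adjoint V ∘L V = 1 := by
    ext x
    refine ext_inner_left ℂ fun y => ?_
    rw [ContinuousLinearMap.comp_apply, ContinuousLinearMap.adjoint_inner_right]
    simp only [V, sum_apply, InnerProductSpace.rankOne_apply, sum_inner, inner_sum, inner_smul_left,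
      inner_smul_right, e.inner_eq_ite, (Fin.castLE_injective hHK).eq_iff]
    simp [← f.sum_inner_mul_inner y x, mul_comm]
  let w : Fin (r + 1) → H →L[ℂ] K := Fin.cons V 0
  have hw : krausMap w = krausMap fun _ : Fin 1 => V := by
    ext1 a
    rw [krausMap_apply, krausMap_apply, Fin.sum_univ_succ]
    simp [w]
  refine ⟨⟨w, ?_⟩, _, hw⟩
  have h1 : krausMap w 1 = 1 := by
    rw [hw, krausMap_apply]
    simp only [Finset.univ_unique, Finset.sum_singleton]
    exact hV
  exact h1

theorem ucpMeasure_EP_pos [Nontrivial H] [Nontrivial K]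
    (h2 : 2 ≤ Module.finrank ℂ H) (hHK : Module.finrank ℂ H ≤ Module.finrank ℂ K) (hr : 1 ≤ r) :
    0 < ucpMeasure H K r (EP H K r) := by
  obtain ⟨w, v, hwv⟩ := exists_param_single (r := r) hHK hr
  refine ucpMeasure_pos isOpen_EP (v := w) ?_
  change PreservesEntanglement (krausMap w.1)
  have h1 := krausMap_one_of_mem w.2
  rw [hwv] at h1 ⊢
  exact preservesEntanglement_krausMap_of_lt (by omega) h1

theorem depolarizing_mem_paramSpace {m n : ℕ} (hm0 : m ≠ 0) (e : OrthonormalBasis (Fin m) ℂ K)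
    (f : OrthonormalBasis (Fin n) ℂ H) : depolarizing e f ∈ ParamSpace H K (m * n) := by
  have h := krausMap_depolarizing e f 1
  have hm : (m : ℂ) ≠ 0 := by exact_mod_cast hm0
  have h1 : ∑ i, ⟪e i, (1 : K →L[ℂ] K) (e i)⟫_ℂ = m := by simp [inner_self_eq_norm_sq_to_K]
  rw [h1, inv_mul_cancel₀ hm, one_smul] at h
  exact h

/-- At maximal rank the complement of `EP` contains a neighborhood of the completely depolarizing
map, and so has positive measure. -/
theorem ucpMeasure_EP_lt_one [Nontrivial H] [Nontrivial K] {m n : ℕ}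
    (hn : Module.finrank ℂ H = n) (hm : Module.finrank ℂ K = m) :
    ucpMeasure H K (m * n) (EP H K (m * n)) < 1 := by
  have hm0 : m ≠ 0 := hm ▸ Module.finrank_pos.ne'
  let e := (stdOrthonormalBasis ℂ K).reindex (finCongr hm)
  let f := (stdOrthonormalBasis ℂ H).reindex (finCongr hn)
  let v₀ : ParamSpace H K (m * n) := ⟨depolarizing e f, depolarizing_mem_paramSpace hm0 e f⟩
  have := isProbabilityMeasure_ucpMeasure v₀
  let O : Set (UCPMaps H K (m * n)) :=
    {φ | ∀ p, ‖(φ.1 - krausMap (depolarizing e f)) (polOp e p)‖ < (8 * (m : ℝ) ^ 2)⁻¹}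
  have hO : IsOpen O := by
    simp only [O, Set.ofPred_forall]
    refine isOpen_iInter_of_finite fun p => isOpen_lt ?_ continuous_const
    exact (((continuous_subtype_val.sub continuous_const).clm_apply continuous_const)).norm
  have hOEP : O ⊆ (EP H K (m * n))ᶜ := by
    intro φ hφ
    obtain ⟨ξ, hξ, hc⟩ := exists_marginallyCyclic H
    rw [Set.mem_compl_iff, mem_EP_iff hξ hc, not_not]
    obtain ⟨s, v, -, h, hv⟩ := exists_krausMap_eq φ
    rw [h]
    exact pulledForm_mem_sepStates_of_near hm0 e f hv (fun p => h ▸ hφ p) hξ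
  have hmem : toUCP v₀ ∈ O := by
    intro p
    change ‖(krausMap (depolarizing e f) - krausMap (depolarizing e f)) (polOp e p)‖ < _
    rw [sub_self, zero_apply, norm_zero]
    positivity
  have hpos := (ucpMeasure_pos hO hmem).trans_le (MeasureTheory.measure_mono hOEP)
  refine lt_of_le_of_ne MeasureTheory.prob_le_one fun h1 => hpos.ne' ?_
  exact (MeasureTheory.prob_compl_eq_zero_iff isOpen_EP.measurableSet).mpr h1

end EntanglementPreserving

end ArvesonUCP

end

theorem theorem4p2 {H K : Type*}
    [NormedAddCommGroup H] [InnerProductSpace ℂ H] [FiniteDimensional ℂ H] [CompleteSpace H]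
    [NormedAddCommGroup K] [InnerProductSpace ℂ K] [FiniteDimensional ℂ K] [CompleteSpace K]
    (n m : ℕ) (hn : Module.finrank ℂ H = n) (hm : Module.finrank ℂ K = m)
    (hn2 : 2 ≤ n) (hnm : n ≤ m) :
    (∀ r : ℕ, 1 ≤ r → r ≤ m * n →
      IsOpen (ArvesonUCP.EP H K r) ∧
        0 < ArvesonUCP.ucpMeasure H K r (ArvesonUCP.EP H K r)) ∧
    (∀ r : ℕ, 1 ≤ r → (r : ℝ) ≤ (n : ℝ) / 2 →
      ArvesonUCP.ucpMeasure H K r (ArvesonUCP.EP H K r) = 1) ∧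
    (0 < ArvesonUCP.ucpMeasure H K (m * n) (ArvesonUCP.EP H K (m * n)) ∧
      ArvesonUCP.ucpMeasure H K (m * n) (ArvesonUCP.EP H K (m * n)) < 1) := by
  have : Nontrivial H := Module.nontrivial_of_finrank_pos (R := ℂ) (by omega)
  have : Nontrivial K := Module.nontrivial_of_finrank_pos (R := ℂ) (by omega)
  have hpos : ∀ r : ℕ, 1 ≤ r → 0 < ArvesonUCP.ucpMeasure H K r (ArvesonUCP.EP H K r) :=
    fun r hr => ArvesonUCP.ucpMeasure_EP_pos (by omega) (by omega) hr
  refine ⟨fun r hr _ => ⟨ArvesonUCP.isOpen_EP, hpos r hr⟩, fun r hr hrn => ?_,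
    hpos _ (Nat.mul_pos (by omega) (by omega)), ArvesonUCP.ucpMeasure_EP_lt_one hn hm⟩
  have hlt : r < n := by
    have h2 : (r : ℝ) * 2 ≤ n := by linarith
    have h3 : r * 2 ≤ n := by exact_mod_cast h2
    omega
  obtain ⟨w, -, -⟩ := ArvesonUCP.exists_param_single (H := H) (K := K) (r := r) (by omega) hr
  have := ArvesonUCP.isProbabilityMeasure_ucpMeasure w
  rw [ArvesonUCP.EP_eq_univ (by omega)]
  exact MeasureTheory.measure_univ
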